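/- Let $M_2=\{0,b,r,1\}$ be the four-element diamond, partially ordered with least element $0$, greatest element $1$, and $b$ (blue) and $r$ (red) incomparable. An $M_2$-colored graph $G=(V,\chi',\chi'')$ consists of a nonempty vertex set $V$, a vertex coloring $\chi':V\to M_2$, and an edge coloring $\chi'':V\times V\to M_2$ with $\chi''(x,x)=0$ and $\chi''(x,y)=\chi''(y,x)$ for all $x,y$. A homomorphism $f$ from $(V_1,\chi_1',\chi_1'')$ to $(V_2,\chi_2',\chi_2'')$ is a map $f:V_1\to V_2$ with $\chi_1'(x)\preceq\chi_2'(f(x))$ and $\chi_1''(x,y)\preceq\chi_2''(f(x),f(y))$ for all $x,y\in V_1$; a monomorphism is an injective homomorphism; an isomorphism is a bijection that preserves all colors. $G$ is HH-homogeneous (respectively MH-homogeneous) if every homomorphism (respectively monomorphism) between finite induced substructures of $G$ extends to an endomorphism of $G$. $G$ is vertex-uniform if all its vertices have the same color. $U(n,\alpha,1)$ denotes the graph with $n$ vertices, all of color $\alpha$, in which any two distinct vertices are joined by an edge of color $1$. In a disjoint union, pairs of vertices from different copies have color $0$. For $\beta\in\{b,r\}$, $H_{(\beta)}$ is the simple graph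 on the vertices of $H$ whose edges are the pairs $\{x,y\}$ with $\chi''(x,y)=\beta$. A Gardiner graph is a graph isomorphic to a disjoint union of $k\ge 1$ copies of the complete graph $K_n$ ($n\ge1$), a complete multipartite graph with $k\ge1$ parts all of the same size $n\ge1$, the $5$-cycle $C_5$, or the line graph $L(K_{3,3})$. Let $G$ be a finite vertex-uniform $M_2$-colored graph in which every vertex has color $\alpha\in M_2$. Then the following are equivalent: 1. $G$ is HH-homogeneous; 2. $G$ is MH-homogeneous; 3. $G$ is (isomorphic to) a disjoint union of $k$ copies of an $M_2$-colored graph $H$, for some $k\ge 1$, where either - $H$ is (isomorphic to) $U(n,\alpha,1)$ for some positive integer $n$; or - $H$ is vertex-uniform, $H_{(r)}$ is a Gardiner graph, and $H_{(b)}$ is the complement of $H_{(r)}$. -/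

import Mathlib

universe u v

/-- An `L`-colored graph on the nonempty vertex set `V`: vertices and pairs of vertices are
colored by elements of `L`; the color `⊥` of a pair means that it is not an edge. -/
structure LColoredGraph (L : Type v) [PartialOrder L] [BoundedOrder L] (V : Type u) where
  nonempty : Nonempty V
  vertexColor : V → L
  edgeColor : V → V → L
  edgeColor_self : ∀ x, edgeColor x x = ⊥
  edgeColor_symm : ∀ x y, x ≠ y → edgeColor x y = edgeColor y x

namespace LColoredGraph

variable {L : Type*} [PartialOrder L] [BoundedOrder L] {V : Type*} {W : Type*}

/-- A homomorphism may only increase the colors of vertices and of pairs of vertices. -/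
def IsHom (G : LColoredGraph L V) (H : LColoredGraph L W) (f : V → W) : Prop :=
  (∀ x, G.vertexColor x ≤ H.vertexColor (f x)) ∧
    ∀ x y, G.edgeColor x y ≤ H.edgeColor (f x) (f y)

/-- A monomorphism is an injective homomorphism. -/
def IsMono (G : LColoredGraph L V) (H : LColoredGraph L W) (f : V → W) : Prop :=
  G.IsHom H f ∧ Function.Injective f

/-- Two `L`-colored graphs are isomorphic if some bijection preserves all colors. -/
def IsIsomorphic (G : LColoredGraph L V) (H : LColoredGraph L W) : Prop :=
  ∃ e : V ≃ W, (∀ x, H.vertexColor (e x) = G.vertexColor x) ∧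
    ∀ x y, H.edgeColor (e x) (e y) = G.edgeColor x y

/-- The substructure induced by a nonempty set `S` of vertices. -/
def induce (G : LColoredGraph L V) (S : Set V) (hS : S.Nonempty) : LColoredGraph L S where
  nonempty := hS.to_subtype
  vertexColor x := G.vertexColor x
  edgeColor x y := G.edgeColor x y
  edgeColor_self x := G.edgeColor_self x
  edgeColor_symm x y h := G.edgeColor_symm x y (fun e => h (Subtype.ext e))

/-- Every homomorphism between finite induced substructures extends to an endomorphism. -/
def IsHHHomogeneous (G : LColoredGraph L V) : Prop :=
  ∀ (S T : Set V) (hS : S.Nonempty) (hT : T.Nonempty), S.Finite → T.Finite →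
    ∀ f : S → T, (G.induce S hS).IsHom (G.induce T hT) f →
      ∃ g : V → V, G.IsHom G g ∧ ∀ x : S, g x = f x

/-- Every monomorphism between finite induced substructures extends to an endomorphism. -/
def IsMHHomogeneous (G : LColoredGraph L V) : Prop :=
  ∀ (S T : Set V) (hS : S.Nonempty) (hT : T.Nonempty), S.Finite → T.Finite →
    ∀ f : S → T, (G.induce S hS).IsMono (G.induce T hT) f →
      ∃ g : V → V, G.IsHom G g ∧ ∀ x : S, g x = f x

/-- All vertices have the same color. -/
def IsVertexUniform (G : LColoredGraph L V) : Prop :=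
  ∃ α : L, ∀ x, G.vertexColor x = α

/-- The uniform graph `U(n, α, β)`: there are `n ≥ 1` vertices, all of color `α`, and any two
distinct vertices are joined by an edge of color `β`. -/
def uniform (n : ℕ) (hn : 1 ≤ n) (α β : L) : LColoredGraph L (Fin n) where
  nonempty := ⟨⟨0, hn⟩⟩
  vertexColor _ := α
  edgeColor x y := if x = y then ⊥ else β
  edgeColor_self x := by simp
  edgeColor_symm x y _ := by simp [eq_comm]

/-- The disjoint union of `k ≥ 1` copies of `H`; the copies are indexed by `Fin k`. -/
def copies (k : ℕ) (hk : 1 ≤ k) (H : LColoredGraph L W) : LColoredGraph L (Fin k × W) where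
  nonempty := H.nonempty.map fun w => (⟨0, hk⟩, w)
  vertexColor x := H.vertexColor x.2
  edgeColor x y := if x.1 = y.1 then H.edgeColor x.2 y.2 else ⊥
  edgeColor_self x := by simp [H.edgeColor_self]
  edgeColor_symm x y h := by
    by_cases h1 : x.1 = y.1
    · have h2 : x.2 ≠ y.2 := fun h2 => h (Prod.ext h1 h2)
      simp [h1, H.edgeColor_symm _ _ h2]
    · simp [h1, Ne.symm h1]

/-- The ordinary graph whose edges are the pairs of distinct vertices of color exactly `α`. -/
def colorGraph (G : LColoredGraph L V) (α : L) : SimpleGraph V where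
  Adj x y := x ≠ y ∧ G.edgeColor x y = α
  symm := ⟨fun x y h => ⟨h.1.symm, (G.edgeColor_symm x y h.1).symm.trans h.2⟩⟩
  loopless := ⟨fun _ h => h.1 rfl⟩

end LColoredGraph

/-- The four elements of the diamond: `zero` is least, `one` is greatest, and `blue` and `red`
are incomparable. -/
inductive M2 : Type
  | zero
  | blue
  | red
  | one

namespace M2

instance : PartialOrder M2 where
  le x y := x = zero ∨ y = one ∨ x = y
  le_refl x := Or.inr (Or.inr rfl)
  le_trans x y z := by cases x <;> cases y <;> cases z <;> simp
  le_antisymm x y := by cases x <;> cases y <;> simp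

instance : BoundedOrder M2 where
  top := one
  le_top _ := Or.inr (Or.inl rfl)
  bot := zero
  bot_le _ := Or.inl rfl

end M2

/-- The disjoint union of `k` complete graphs with `n` vertices each. -/
def disjointCompleteGraphs (k n : ℕ) : SimpleGraph (Fin k × Fin n) where
  Adj x y := x.1 = y.1 ∧ x.2 ≠ y.2
  symm := ⟨fun _ _ h => ⟨h.1.symm, h.2.symm⟩⟩
  loopless := ⟨fun _ h => h.2 rfl⟩

/-- The Gardiner graphs, up to isomorphism: the disjoint unions of complete graphs of the same
size, the complete multipartite graphs with parts of the same size, the 5-cycle, and the line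
graph of `K_{3,3}`. -/
def IsGardinerGraph {V : Type*} (Γ : SimpleGraph V) : Prop :=
  (∃ k n : ℕ, 1 ≤ k ∧ 1 ≤ n ∧ Nonempty (Γ ≃g disjointCompleteGraphs k n)) ∨
  (∃ k n : ℕ, 1 ≤ k ∧ 1 ≤ n ∧
    Nonempty (Γ ≃g SimpleGraph.completeMultipartiteGraph fun _ : Fin k => Fin n)) ∨
  Nonempty (Γ ≃g SimpleGraph.cycleGraph 5) ∨
  Nonempty (Γ ≃g (completeBipartiteGraph (Fin 3) (Fin 3)).lineGraph)

/-! From 2 to 3, consider the graph of all pairs of nonzero color, `support`. If a vertex z outside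
a maximum clique K were adjacent to some k in K, then sending z to k and fixing the members of K not
joined to z would extend to an endomorphism g, and g(K) together with k would be a larger clique
(`IsMHHomogeneous.mem_of_adj`). So the support is a disjoint union of cliques of equal size, and
endomorphisms are bijective between components. They also preserve colors there: returning to the
start gives a permutation of finite order along which colors only rise
(`IsMHHomogeneous.edgeColor_map`). Hence all components are isomorphic. If color 1 occurs, any edge
can be sent onto an edge of color 1, so all edges have that color. Otherwise each component is
completely colored in red and blue, partial isomorphisms of its red graph are monomorphisms of G,
and the red graph is ultrahomogeneous.

Gardiner's theorem (`IsUltrahomogeneous.isGardinerGraph`) goes by induction on the number of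
vertices, since neighborhoods are again ultrahomogeneous. Suppose that neither Γ nor its complement
is a disjoint union of complete graphs. If the neighborhoods are such unions, Γ is the 5-cycle (no
triangles) or the 3 × 3 rook's graph, which is the line graph of K_{3,3}. If only their complements
are, nonadjacency is transitive in all of Γ, a contradiction. Otherwise a neighborhood is itself the
5-cycle or the rook's graph, so the degree is 5 or 9. The same alternatives hold for the complement,
and odd degrees in both contradict the handshake lemma.

From 3 to 1, a homomorphism cannot collapse a pair of nonzero color, nor change red or blue when 1
is absent. On one copy a partial homomorphism is thus a partial injection (all edges of color 1) or
a partial isomorphism of the red graph, and Gardiner graphs are ultrahomogeneous. No copy is torn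
apart, so the extension is made copy by copy. -/

namespace SimpleGraph

/-- Every isomorphism between induced subgraphs extends to an automorphism. -/
def IsUltrahomogeneous {V : Type*} (Γ : SimpleGraph V) : Prop :=
  ∀ (S : Set V) (f : V → V), Set.InjOn f S →
    (∀ x ∈ S, ∀ y ∈ S, (Γ.Adj (f x) (f y) ↔ Γ.Adj x y)) →
      ∃ σ : Γ ≃g Γ, ∀ x ∈ S, σ x = f x

/-- Adjacency-or-equality is transitive: the graph is a disjoint union of complete graphs. -/
def IsClusterGraph {V : Type*} (Γ : SimpleGraph V) : Prop :=
  ∀ x y z, Γ.Adj x y → Γ.Adj y z → x ≠ z → Γ.Adj x z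

/-- The `3 × 3` rook's graph. -/
def rookGraph : SimpleGraph (Fin 3 × Fin 3) where
  Adj x y := x ≠ y ∧ (x.1 = y.1 ∨ x.2 = y.2)
  symm := ⟨fun _ _ h => ⟨h.1.symm, h.2.imp Eq.symm Eq.symm⟩⟩
  loopless := ⟨fun _ h => h.1 rfl⟩

instance : DecidableRel rookGraph.Adj := fun x y =>
  inferInstanceAs (Decidable (x ≠ y ∧ (x.1 = y.1 ∨ x.2 = y.2)))

/-! ### Ultrahomogeneity: moving tuples, complements, neighborhoods -/

namespace IsUltrahomogeneous

variable {V W : Type*} {Γ : SimpleGraph V} {Δ : SimpleGraph W}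

/-- Tuples replace subsets, so that a partial isomorphism can be given by listing values, or over
`Option S` when one vertex is added to a set. -/
theorem exists_iso (h : Γ.IsUltrahomogeneous) {ι : Type*} (a b : ι → V)
    (heq : ∀ i j, a i = a j ↔ b i = b j)
    (hadj : ∀ i j, Γ.Adj (b i) (b j) ↔ Γ.Adj (a i) (a j)) :
    ∃ σ : Γ ≃g Γ, ∀ i, σ (a i) = b i := by
  have hf : ∀ i, Function.extend a b id (a i) = b i := fun i =>
    Function.FactorsThrough.extend_apply (fun i j hij => (heq i j).1 hij) id i
  obtain ⟨σ, hσ⟩ := h (Set.range a) (Function.extend a b id)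
    (by rintro _ ⟨i, rfl⟩ _ ⟨j, rfl⟩ hij; rw [hf, hf] at hij; exact (heq i j).2 hij)
    (by rintro _ ⟨i, rfl⟩ _ ⟨j, rfl⟩; rw [hf, hf]; exact hadj i j)
  exact ⟨σ, fun i => (hσ _ ⟨i, rfl⟩).trans (hf i)⟩

theorem exists_iso_one (h : Γ.IsUltrahomogeneous) (x y : V) : ∃ σ : Γ ≃g Γ, σ x = y := by
  obtain ⟨σ, hσ⟩ := h.exists_iso (fun _ : Unit => x) (fun _ => y) (by simp) (by simp)
  exact ⟨σ, hσ ()⟩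

theorem exists_iso_two (h : Γ.IsUltrahomogeneous) {a b a' b' : V} (hab : a ≠ b) (hab' : a' ≠ b')
    (e : Γ.Adj a' b' ↔ Γ.Adj a b) : ∃ σ : Γ ≃g Γ, σ a = a' ∧ σ b = b' := by
  obtain ⟨σ, hσ⟩ := h.exists_iso ![a, b] ![a', b']
    (by simp [Fin.forall_fin_succ, hab, hab', hab.symm, hab'.symm])
    (by simp [Fin.forall_fin_succ, e, Γ.adj_comm b, Γ.adj_comm b'])
  exact ⟨σ, hσ 0, hσ 1⟩

theorem exists_iso_three (h : Γ.IsUltrahomogeneous) {a b c a' b' c' : V}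
    (hab : a ≠ b) (hac : a ≠ c) (hbc : b ≠ c) (hab' : a' ≠ b') (hac' : a' ≠ c') (hbc' : b' ≠ c')
    (e : Γ.Adj a' b' ↔ Γ.Adj a b) (e1 : Γ.Adj a' c' ↔ Γ.Adj a c) (e2 : Γ.Adj b' c' ↔ Γ.Adj b c) :
    ∃ σ : Γ ≃g Γ, σ a = a' ∧ σ b = b' ∧ σ c = c' := by
  obtain ⟨σ, hσ⟩ := h.exists_iso ![a, b, c] ![a', b', c']
    (by simp [Fin.forall_fin_succ, hab, hab', hab.symm, hab'.symm, hac, hac', hac.symm, hac'.symm,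
      hbc, hbc', hbc.symm, hbc'.symm])
    (by simp [Fin.forall_fin_succ, e, e1, e2, Γ.adj_comm b a, Γ.adj_comm b' a', Γ.adj_comm c,
      Γ.adj_comm c'])
  exact ⟨σ, hσ 0, hσ 1, hσ 2⟩

theorem exists_iso_four (h : Γ.IsUltrahomogeneous) {a b c d a' b' c' d' : V}
    (hab : a ≠ b) (hac : a ≠ c) (had : a ≠ d) (hbc : b ≠ c) (hbd : b ≠ d) (hcd : c ≠ d)
    (hab' : a' ≠ b') (hac' : a' ≠ c') (had' : a' ≠ d') (hbc' : b' ≠ c') (hbd' : b' ≠ d')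
    (hcd' : c' ≠ d')
    (e : Γ.Adj a' b' ↔ Γ.Adj a b) (e1 : Γ.Adj a' c' ↔ Γ.Adj a c) (e2 : Γ.Adj a' d' ↔ Γ.Adj a d)
    (e3 : Γ.Adj b' c' ↔ Γ.Adj b c) (e4 : Γ.Adj b' d' ↔ Γ.Adj b d)
    (e5 : Γ.Adj c' d' ↔ Γ.Adj c d) :
    ∃ σ : Γ ≃g Γ, σ a = a' ∧ σ b = b' ∧ σ c = c' ∧ σ d = d' := by
  obtain ⟨σ, hσ⟩ := h.exists_iso ![a, b, c, d] ![a', b', c', d']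
    (by simp [Fin.forall_fin_succ, hab, hab', hab.symm, hab'.symm, hac, hac', hac.symm, hac'.symm,
      hbc, hbc', hbc.symm, hbc'.symm, had, had', had.symm, had'.symm, hbd, hbd', hbd.symm,
      hbd'.symm, hcd, hcd', hcd.symm, hcd'.symm])
    (by simp [Fin.forall_fin_succ, e, e1, e2, e3, e4, e5, Γ.adj_comm b a, Γ.adj_comm b' a',
      Γ.adj_comm c a, Γ.adj_comm c' a', Γ.adj_comm c b, Γ.adj_comm c' b', Γ.adj_comm d,
      Γ.adj_comm d'])
  exact ⟨σ, hσ 0, hσ 1, hσ 2, hσ 3⟩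

theorem compl (h : Γ.IsUltrahomogeneous) : Γᶜ.IsUltrahomogeneous := by
  intro S f hf hadj
  obtain ⟨σ, hσ⟩ := h S f hf fun x hx y hy => by
    by_cases hxy : x = y
    · subst hxy; simp
    · have := hadj x hx y hy
      have hne : f x ≠ f y := fun e => hxy (hf hx hy e)
      simp only [compl_adj, hxy, hne, ne_eq, not_false_eq_true, true_and] at this
      exact not_iff_not.1 this
  exact ⟨⟨σ.toEquiv, by
    intro a b
    simpa [compl_adj] using fun _ => not_congr σ.map_adj_iff⟩, hσ⟩

theorem of_iso (e : Γ ≃g Δ) (h : Δ.IsUltrahomogeneous) : Γ.IsUltrahomogeneous := by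
  intro S f hf hadj
  obtain ⟨σ, hσ⟩ := h.exists_iso (fun s : S => e s) (fun s : S => e (f s))
    (fun i j => by simpa using ⟨fun hij => by rw [hij], fun hij => hf i.2 j.2 hij⟩)
    (fun i j => e.map_adj_iff.trans ((hadj i i.2 j j.2).trans e.map_adj_iff.symm))
  refine ⟨(e.trans σ).trans e.symm, fun x hx => ?_⟩
  have := hσ ⟨x, hx⟩
  simp only at this
  simp [this]

/-- Adding v ↦ v to a partial isomorphism of the neighborhood gives one of Γ, and an automorphism
fixing v restricts to the neighborhood. -/
theorem induce_neighborSet (h : Γ.IsUltrahomogeneous) (v : V) :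
    (Γ.induce (Γ.neighborSet v)).IsUltrahomogeneous := by
  intro S f hf hadj
  obtain ⟨σ, hσ⟩ := h.exists_iso (ι := Option S) (fun i => i.elim v fun s => (s : Γ.neighborSet v))
    (fun i => i.elim v fun s => (f s : Γ.neighborSet v))
    (by
      have key : ∀ y : Γ.neighborSet v, v ≠ y := fun y => y.2.ne
      rintro (_ | i) (_ | j)
      · simp
      · simp [key]
      · simp [(key _).symm]
      · simpa [Subtype.ext_iff] using
          ⟨fun hij => by rw [Subtype.ext hij], fun hij =>
            congrArg Subtype.val (hf i.2 j.2 (Subtype.ext hij))⟩)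
    (by
      have key : ∀ y : Γ.neighborSet v, Γ.Adj v y := fun y => y.2
      rintro (_ | i) (_ | j)
      · simp
      · simp [key]
      · simp [(key _).symm]
      · simpa using hadj i i.2 j j.2)
  have hv : σ v = v := hσ none
  have hmem : ∀ x, x ∈ Γ.neighborSet v ↔ σ x ∈ Γ.neighborSet v := by
    intro x
    rw [mem_neighborSet, mem_neighborSet]
    conv_rhs => rw [← hv]
    exact σ.map_adj_iff.symm
  refine ⟨⟨σ.toEquiv.subtypeEquiv hmem, ?_⟩, fun x hx => Subtype.ext (hσ (some ⟨x, hx⟩))⟩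
  intro a b
  exact σ.map_adj_iff

end IsUltrahomogeneous

end SimpleGraph

namespace SimpleGraph

/-! ### Cluster graphs and neighborhoods -/

section Basic

variable {V W : Type*} {Γ : SimpleGraph V} {Δ : SimpleGraph W}

/-- When no two vertices of Δ have the same neighbors, injectivity follows from preservation of
adjacency. This spares checking that the listed vertices of Γ are distinct. -/
theorem nonempty_iso_of_surjective (φ : W → V) (hφ : Function.Surjective φ)
    (hadj : ∀ i j, Γ.Adj (φ i) (φ j) ↔ Δ.Adj i j)
    (htwin : ∀ i j, (∀ k, Δ.Adj i k ↔ Δ.Adj j k) → i = j) : Nonempty (Γ ≃g Δ) := by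
  have hinj : Function.Injective φ := fun i j hij =>
    htwin i j fun k => by rw [← hadj, ← hadj, hij]
  let e : Δ ≃g Γ := ⟨Equiv.ofBijective φ ⟨hinj, hφ⟩, by intro a b; exact hadj a b⟩
  exact ⟨e.symm⟩

theorem isClusterGraph_compl_iff :
    Γᶜ.IsClusterGraph ↔ ∀ x y z, ¬Γ.Adj x y → ¬Γ.Adj y z → ¬Γ.Adj x z := by
  constructor
  · intro h x y z hxy hyz
    by_cases e1 : x = y
    · exact e1 ▸ hyz
    by_cases e2 : y = z
    · exact e2 ▸ hxy
    by_cases e3 : x = z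
    · simp [e3]
    exact ((compl_adj _ _ _).1 (h x y z ((compl_adj _ _ _).2 ⟨e1, hxy⟩)
      ((compl_adj _ _ _).2 ⟨e2, hyz⟩) e3)).2
  · intro h x y z hxy hyz hne
    rw [compl_adj] at *
    exact ⟨hne, h x y z hxy.2 hyz.2⟩

namespace IsUltrahomogeneous

/-- An induced path x, y, z inside the neighborhood of v shows that nonadjacent vertices have the
same neighbors. This holds first for x and z, then for every nonadjacent pair by homogeneity. -/
theorem isClusterGraph_compl_of_neighborSet (h : Γ.IsUltrahomogeneous) (v : V)
    (hco : (Γ.induce (Γ.neighborSet v))ᶜ.IsClusterGraph)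
    (hcl : ¬(Γ.induce (Γ.neighborSet v)).IsClusterGraph) : Γᶜ.IsClusterGraph := by
  rw [isClusterGraph_compl_iff] at hco
  have hco' : ∀ u x y z, Γ.Adj u x → Γ.Adj u y → Γ.Adj u z → ¬Γ.Adj x y → ¬Γ.Adj y z →
      ¬Γ.Adj x z := by
    intro u x y z hx hy hz hxy hyz hxz
    obtain ⟨σ, hσ⟩ := h.exists_iso_one u v
    have key : ∀ {x}, Γ.Adj u x → Γ.Adj v (σ x) := fun hx => hσ ▸ σ.map_adj_iff.2 hx
    exact hco ⟨σ x, key hx⟩ ⟨σ y, key hy⟩ ⟨σ z, key hz⟩ (fun e => hxy (σ.map_adj_iff.1 e))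
      (fun e => hyz (σ.map_adj_iff.1 e)) (σ.map_adj_iff.2 hxz)
  simp only [IsClusterGraph, not_forall] at hcl
  obtain ⟨⟨x, hx⟩, ⟨y, hy⟩, ⟨z, hz⟩, hxy, hyz, hne, hxz⟩ := hcl
  simp only [comap_adj, Function.Embedding.subtype_apply] at *
  have hne' : x ≠ z := fun e => hne (Subtype.ext e)
  -- If u were adjacent to x but not to z, transitivity of nonadjacency would fail in the
  -- neighborhood of v (when u ~ v), of y (when u ~ y), or of x, where u would be nonadjacent to
  -- both ends of the edge vy.
  have hsub : ∀ u, Γ.Adj x u → Γ.Adj z u := by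
    intro u hu
    by_contra hzu
    by_cases huv : Γ.Adj v u
    · exact hco' v x z u hx hz huv hxz hzu hu
    by_cases huy : Γ.Adj y u
    · exact hco' y x z u hxy.symm hyz huy hxz hzu hu
    · exact hco' x v u y hx.symm hu hxy huv (fun e => huy e.symm) hy
  have hall : ∀ a b c, a ≠ b → ¬Γ.Adj a b → Γ.Adj a c → Γ.Adj b c := by
    intro a b c hab hadj hac
    obtain ⟨σ, rfl, rfl⟩ := h.exists_iso_two hne' hab (by simp [hadj, hxz])
    have := hsub (σ.symm c) (by rw [← σ.map_adj_iff]; simpa using hac)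
    rw [← σ.map_adj_iff] at this
    simpa using this
  rw [isClusterGraph_compl_iff]
  intro a b c hab hbc hac
  by_cases e : a = b
  · exact hbc (e ▸ hac)
  · exact hbc (hall a b c e hab hac)

theorem isClusterGraph_neighborSet_iff (h : Γ.IsUltrahomogeneous) (v : V) :
    (Γ.induce (Γ.neighborSet v)).IsClusterGraph ↔
      ∀ u x y z, Γ.Adj u x → Γ.Adj u y → Γ.Adj u z → Γ.Adj x y → Γ.Adj y z → x ≠ z →
        Γ.Adj x z := by
  constructor
  · intro hcl u x y z hx hy hz hxy hyz hxz
    obtain ⟨σ, hσ⟩ := h.exists_iso_one u v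
    have key : ∀ {x}, Γ.Adj u x → Γ.Adj v (σ x) := fun hx => hσ ▸ σ.map_adj_iff.2 hx
    exact σ.map_adj_iff.1 (hcl ⟨σ x, key hx⟩ ⟨σ y, key hy⟩ ⟨σ z, key hz⟩ (σ.map_adj_iff.2 hxy)
      (σ.map_adj_iff.2 hyz) (by simpa [Subtype.ext_iff] using hxz))
  · intro H x y z hxy hyz hne
    exact H v x y z x.2 y.2 z.2 hxy hyz fun e => hne (Subtype.ext e)

theorem exists_common_neighbor (h : Γ.IsUltrahomogeneous) (hc : ¬Γ.IsClusterGraph) {a b : V}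
    (hab : a ≠ b) (hadj : ¬Γ.Adj a b) : ∃ c, Γ.Adj a c ∧ Γ.Adj b c := by
  simp only [IsClusterGraph, not_forall] at hc
  obtain ⟨x, y, z, hxy, hyz, hne, hxz⟩ := hc
  obtain ⟨σ, rfl, rfl⟩ := h.exists_iso_two hne hab (by simp [hadj, hxz])
  exact ⟨σ y, σ.map_adj_iff.2 hxy, σ.map_adj_iff.2 hyz.symm⟩

theorem exists_not_adj (h : Γ.IsUltrahomogeneous) (hc : ¬Γ.IsClusterGraph) (v : V) :
    ∃ w, v ≠ w ∧ ¬Γ.Adj v w := by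
  simp only [IsClusterGraph, not_forall] at hc
  obtain ⟨x, y, z, hxy, hyz, hne, hxz⟩ := hc
  obtain ⟨σ, rfl⟩ := h.exists_iso_one x v
  exact ⟨σ z, by simpa using hne, fun e => hxz (σ.map_adj_iff.1 e)⟩

end IsUltrahomogeneous

end Basic

/-! ### The triangle-free case: the 5-cycle -/

section TriangleFree

variable {V : Type*} {Γ : SimpleGraph V} [Finite V]

namespace IsUltrahomogeneous

/-- Neighborhoods are independent, so t can be replaced by w while N(v) \ N(w) is fixed. The image u
of v is adjacent to w and to all of N(v) \ N(w). Since (v, w, w') and (v, w, u) have the same type,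
N(v) ∩ N(w') and N(v) ∩ N(u) have equal size; the first lies in the second, so they coincide. -/
theorem adj_iff_not_adj_of_triangleFree (h : Γ.IsUltrahomogeneous) (hc : ¬Γ.IsClusterGraph)
    (ht : ∀ x y z, Γ.Adj x y → Γ.Adj y z → ¬Γ.Adj x z) {v w w' : V} (hw : ¬Γ.Adj v w)
    (hw' : ¬Γ.Adj v w') (hww : Γ.Adj w w') {x : V} (hx : Γ.Adj v x) :
    Γ.Adj w' x ↔ ¬Γ.Adj w x := by
  have hvw : v ≠ w := fun e => hw' (e ▸ hww)
  have hvw' : v ≠ w' := fun e => hw (e ▸ hww.symm)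
  refine ⟨fun h1 h2 => ht w w' x hww h1 h2, fun hwx => ?_⟩
  obtain ⟨t, hvt, hwt⟩ := h.exists_common_neighbor hc hvw hw
  obtain ⟨t', hvt', hwt'⟩ := h.exists_common_neighbor hc hvw' hw'
  classical
  have hf : ∀ y, Γ.Adj v y → ¬Γ.Adj w y → (if y = t then w else y) = y := by
    intro y _ hy
    rw [if_neg]
    rintro rfl
    exact hy hwt
  obtain ⟨σ, hσ⟩ := h (insert t {y | Γ.Adj v y ∧ ¬Γ.Adj w y}) (fun y => if y = t then w else y)
    (by
      rintro y (rfl | ⟨hy, hwy⟩) z (rfl | ⟨hz, hwz⟩) hyz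
      · rfl
      · simp only [hf z hz hwz, if_pos] at hyz
        exact absurd (hyz ▸ hz) hw
      · simp only [hf y hy hwy, if_pos] at hyz
        exact absurd (hyz ▸ hy) hw
      · simpa only [hf y hy hwy, hf z hz hwz] using hyz)
    (by
      rintro y (rfl | ⟨hy, hwy⟩) z (rfl | ⟨hz, hwz⟩)
      · simp
      · simp only [hf z hz hwz, if_pos]
        exact iff_of_false hwz (ht _ _ _ hvt.symm hz)
      · simp only [hf y hy hwy, if_pos]
        exact iff_of_false (fun e => hwy e.symm) (ht _ _ _ hy.symm hvt)
      · simp only [hf y hy hwy, hf z hz hwz])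
  have huw : Γ.Adj (σ v) w := by
    have := hσ t (Set.mem_insert _ _)
    simp only [if_pos] at this
    rw [← this]
    exact σ.map_adj_iff.2 hvt
  have hu : ∀ y, Γ.Adj v y → ¬Γ.Adj w y → Γ.Adj (σ v) y := by
    intro y hy hwy
    have := hσ y (Or.inr ⟨hy, hwy⟩)
    simp only [hf y hy hwy] at this
    rw [← this]
    exact σ.map_adj_iff.2 hy
  have hwt2 : ¬Γ.Adj w t' := ht _ _ _ hww hwt'
  have hvu : ¬Γ.Adj v (σ v) := fun e => ht _ _ _ e (hu t' hvt' hwt2) hvt'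
  have hvu' : v ≠ σ v := fun e => hw (e.symm ▸ huw)
  obtain ⟨τ, hτv, hτw, hτ⟩ := h.exists_iso_three (a := v) (b := w) (c := w') (a' := v) (b' := w)
    (c' := σ v) hvw hvw' hww.ne hvw hvu' huw.ne' Iff.rfl (by simp [hvu, hw'])
    (by simp [huw.symm, hww])
  have himg : τ '' {y | Γ.Adj v y ∧ Γ.Adj w' y} = {y | Γ.Adj v y ∧ Γ.Adj (σ v) y} := by
    ext y
    constructor
    · rintro ⟨y, ⟨h1, h2⟩, rfl⟩
      refine ⟨?_, ?_⟩
      · conv_lhs => rw [← hτv]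
        exact τ.map_adj_iff.2 h1
      · rw [← hτ]
        exact τ.map_adj_iff.2 h2
    · rintro ⟨h1, h2⟩
      refine ⟨τ.symm y, ⟨?_, ?_⟩, by simp⟩
      · rw [← τ.map_adj_iff]
        simpa [hτv] using h1
      · rw [← τ.map_adj_iff]
        simpa [hτ] using h2
  have heq : {y | Γ.Adj v y ∧ Γ.Adj w' y} = {y | Γ.Adj v y ∧ Γ.Adj (σ v) y} := by
    apply Set.eq_of_subset_of_ncard_le
    · rintro y ⟨h1, h2⟩
      exact ⟨h1, hu y h1 (ht _ _ _ hww h2)⟩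
    · rw [← himg]
      exact Set.ncard_image_le (Set.toFinite _)
    · exact Set.toFinite _
  have : x ∈ {y | Γ.Adj v y ∧ Γ.Adj (σ v) y} := ⟨hx, hu x hx hwx⟩
  rw [← heq] at this
  exact this.2

/-- Given a second common neighbor x, two vertices are compared with w: w2, with the same trace on
N(v) as w, and the image `σ w`, whose trace has t replaced by t'. Over v and w they have the same
type, which is absurd. -/
theorem eq_of_common_neighbor_of_triangleFree (h : Γ.IsUltrahomogeneous)
    (hc : ¬Γ.IsClusterGraph) (ht : ∀ x y z, Γ.Adj x y → Γ.Adj y z → ¬Γ.Adj x z) {v w w' : V}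
    (hw : ¬Γ.Adj v w) (hw' : ¬Γ.Adj v w') (hww : Γ.Adj w w') {t x : V} (hvt : Γ.Adj v t)
    (hwt : Γ.Adj w t) (hvx : Γ.Adj v x) (hwx : Γ.Adj w x) : x = t := by
  classical
  by_contra hxt
  have hvw : v ≠ w := fun e => hw' (e ▸ hww)
  have hvw' : v ≠ w' := fun e => hw (e ▸ hww.symm)
  obtain ⟨t', hvt', hwt'⟩ := h.exists_common_neighbor hc hvw' hw'
  have hwt2 : ¬Γ.Adj w t' := ht _ _ _ hww hwt'
  have htt' : t ≠ t' := fun e => hwt2 (e ▸ hwt)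
  have hxt' : x ≠ t' := fun e => hwt2 (e ▸ hwx)
  have hfix : ∀ y, y ≠ t → y ≠ t' → Equiv.swap t t' y = y :=
    fun y => Equiv.swap_apply_of_ne_of_ne
  have hmem : ∀ y, Γ.Adj v y → Γ.Adj v (Equiv.swap t t' y) := by
    intro y hy
    by_cases h1 : y = t
    · rw [h1, Equiv.swap_apply_left]; exact hvt'
    by_cases h2 : y = t'
    · rw [h2, Equiv.swap_apply_right]; exact hvt
    rwa [hfix y h1 h2]
  have hfv : Equiv.swap t t' v = v := hfix v hvt.ne hvt'.ne
  -- Any permutation of the independent set N(v) extends to an automorphism fixing v.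
  obtain ⟨σ, hσ⟩ := h (insert v {y | Γ.Adj v y}) (Equiv.swap t t') (Equiv.injective _).injOn
    (by
      rintro y (rfl | hy) z (rfl | hz)
      · simp
      · rw [hfv]; exact iff_of_true (hmem z hz) hz
      · rw [hfv]; exact iff_of_true (hmem y hy).symm hy.symm
      · exact iff_of_false (ht _ _ _ (hmem y hy).symm (hmem z hz)) (ht _ _ _ hy.symm hz))
  have hσv : σ v = v := (hσ v (Or.inl rfl)).trans hfv
  have hσx : σ x = x := (hσ x (Or.inr hvx)).trans (hfix x hxt hxt')
  have hσt : σ t = t' := (hσ t (Or.inr hvt)).trans (Equiv.swap_apply_left _ _)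
  have hw1x : Γ.Adj (σ w) x := by rw [← hσx]; exact σ.map_adj_iff.2 hwx
  have hw1t : Γ.Adj (σ w) t' := by rw [← hσt]; exact σ.map_adj_iff.2 hwt
  have hvw1 : ¬Γ.Adj v (σ w) := by
    intro e
    rw [← hσv] at e
    exact hw (σ.map_adj_iff.1 e)
  have hww1 : w ≠ σ w := fun e => hwt2 (e.symm ▸ hw1t)
  have hadj1 : ¬Γ.Adj w (σ w) := ht _ _ _ hwx hw1x.symm
  have hvw1' : v ≠ σ w := fun e => hvw (σ.injective (hσv.trans e))
  -- Exchanging v and w' carries t and x to two neighbors of w' outside N(v), and at least one of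
  -- them is not w.
  obtain ⟨w2, hw2w, hw2w', hvw2⟩ : ∃ w2, w2 ≠ w ∧ Γ.Adj w' w2 ∧ ¬Γ.Adj v w2 := by
    obtain ⟨τ, hτv, hτw⟩ := h.exists_iso_two (a := v) (b := w') (a' := w') (b' := v) hvw' hvw'.symm
      (by simp [hw', Γ.adj_comm w' v])
    have key : ∀ y, Γ.Adj v y → Γ.Adj w y → Γ.Adj w' (τ y) ∧ ¬Γ.Adj v (τ y) := by
      intro y h1 h2
      constructor
      · rw [← hτv]; exact τ.map_adj_iff.2 h1
      · rw [← hτw]; exact fun e => ht _ _ _ hww (τ.map_adj_iff.1 e) h2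
    by_cases e : τ t = w
    · exact ⟨τ x, fun e' => hxt (τ.injective (e'.trans e.symm)), key x hvx hwx⟩
    · exact ⟨τ t, e, key t hvt hwt⟩
  -- The traces of w and of w2 on N(v) are both complementary to that of w'.
  have hT : ∀ y, Γ.Adj v y → (Γ.Adj w2 y ↔ Γ.Adj w y) := by
    intro y hy
    rw [h.adj_iff_not_adj_of_triangleFree hc ht hw' hvw2 hw2w' hy,
      h.adj_iff_not_adj_of_triangleFree hc ht hw hw' hww hy, not_not]
  have hw2 : ¬Γ.Adj w w2 := ht _ _ _ hwt ((hT t hvt).2 hwt).symm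
  have hvw2' : v ≠ w2 := fun e => hw' (e ▸ hw2w').symm
  obtain ⟨τ, hτv, hτw, hτ⟩ := h.exists_iso_three (a := v) (b := w) (c := w2) (a' := v) (b' := w)
    (c' := σ w) hvw hvw2' hw2w.symm hvw hvw1' hww1 Iff.rfl (by simp [hvw1, hvw2])
    (by simp [hadj1, hw2])
  have e1 : Γ.Adj v (τ.symm t') := by rw [← τ.map_adj_iff]; simpa [hτv] using hvt'
  have e2 : Γ.Adj w2 (τ.symm t') := by rw [← τ.map_adj_iff]; simpa [hτ] using hw1t
  have e3 := (hT _ e1).1 e2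
  rw [← τ.map_adj_iff] at e3
  exact hwt2 (by simpa [hτw] using e3)

theorem nonempty_iso_cycleGraph_of_triangleFree (h : Γ.IsUltrahomogeneous)
    (hc : ¬Γ.IsClusterGraph) (hcc : ¬Γᶜ.IsClusterGraph)
    (ht : ∀ x y z, Γ.Adj x y → Γ.Adj y z → ¬Γ.Adj x z) : Nonempty (Γ ≃g cycleGraph 5) := by
  rw [isClusterGraph_compl_iff] at hcc
  push Not at hcc
  obtain ⟨w, v, w', hw, hw', hww⟩ := hcc
  rw [adj_comm] at hw
  have hvw : v ≠ w := fun e => hw' (e ▸ hww)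
  have hvw' : v ≠ w' := fun e => hw (e ▸ hww.symm)
  obtain ⟨t, hvt, hwt⟩ := h.exists_common_neighbor hc hvw hw
  obtain ⟨t', hvt', hwt'⟩ := h.exists_common_neighbor hc hvw' hw'
  have hN : ∀ x, Γ.Adj v x → x = t ∨ x = t' := by
    intro x hx
    by_cases hwx : Γ.Adj w x
    · exact Or.inl (h.eq_of_common_neighbor_of_triangleFree hc ht hw hw' hww hvt hwt hx hwx)
    · exact Or.inr (h.eq_of_common_neighbor_of_triangleFree hc ht hw' hw hww.symm hvt' hwt' hx
        ((h.adj_iff_not_adj_of_triangleFree hc ht hw hw' hww hx).2 hwx))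
  have hdeg : ∀ a x y z, Γ.Adj a x → Γ.Adj a y → Γ.Adj a z → x = y ∨ y = z ∨ x = z := by
    intro a x y z hx hy hz
    obtain ⟨σ, rfl⟩ := h.exists_iso_one a v
    have hx := hN _ (σ.map_adj_iff.2 hx)
    have hy := hN _ (σ.map_adj_iff.2 hy)
    have hz := hN _ (σ.map_adj_iff.2 hz)
    simp only [← σ.injective.eq_iff (a := x), ← σ.injective.eq_iff (a := y)]
    grind
  have hwt2 : ¬Γ.Adj w t' := ht _ _ _ hww hwt'
  have hwt3 : ¬Γ.Adj w' t := ht _ _ _ hww.symm hwt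
  have htt : ¬Γ.Adj t t' := ht _ _ _ hvt.symm hvt'
  -- Any vertex not adjacent to v shares with v one of the neighbors t, t', each of which has only
  -- two neighbors, so these five vertices are all.
  refine nonempty_iso_of_surjective ![v, t, w, w', t'] ?_ ?_ (by decide)
  · intro u
    by_cases huv : v = u
    · exact ⟨0, huv⟩
    by_cases hadj : Γ.Adj v u
    · rcases hN u hadj with rfl | rfl
      · exact ⟨1, rfl⟩
      · exact ⟨4, rfl⟩
    obtain ⟨c, hvc, huc⟩ := h.exists_common_neighbor hc huv hadj
    rcases hN c hvc with rfl | rfl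
    · exact ⟨2, by simpa [hvw, huv] using hdeg c v w u hvt.symm hwt.symm huc.symm⟩
    · exact ⟨3, by simpa [hvw', huv] using hdeg c v w' u hvt'.symm hwt'.symm huc.symm⟩
  · have hC : ∀ i j : Fin 5, (cycleGraph 5).Adj i j ↔ (i.val + 1) % 5 = j.val ∨
        (j.val + 1) % 5 = i.val := by decide
    simp only [hC]
    simp [Fin.forall_fin_succ, hw, hw', hvt, hwt, hvt', hwt', hww, hwt2, hwt3, htt, Γ.adj_comm t,
      Γ.adj_comm t', Γ.adj_comm w v, Γ.adj_comm w' v, hww.symm]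

end IsUltrahomogeneous

end TriangleFree

end SimpleGraph

namespace SimpleGraph

/-! ### Triangles without induced diamonds: the rook's graph -/

section LocallyCluster

variable {V : Type*} {Γ : SimpleGraph V}

/-- In every neighborhood, adjacency-or-equality is transitive: there is no induced diamond. -/
def IsLocallyCluster (Γ : SimpleGraph V) : Prop :=
  ∀ u x y z, Γ.Adj u x → Γ.Adj u y → Γ.Adj u z → Γ.Adj x y → Γ.Adj y z → x ≠ z → Γ.Adj x z

theorem adj_iff_of_iso (σ : Γ ≃g Γ) {a b a' b' : V} (ha : σ a = a') (hb : σ b = b') :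
    Γ.Adj a' b' ↔ Γ.Adj a b := by
  subst ha hb
  exact σ.map_adj_iff

namespace IsLocallyCluster

theorem trans (hl : Γ.IsLocallyCluster) {u x y z : V} (hx : Γ.Adj u x) (hy : Γ.Adj u y)
    (hz : Γ.Adj u z) (hxy : x = y ∨ Γ.Adj x y) (hyz : y = z ∨ Γ.Adj y z) :
    x = z ∨ Γ.Adj x z := by
  rcases hxy with rfl | hxy
  · exact hyz
  rcases hyz with rfl | hyz
  · exact Or.inr hxy
  · by_cases e : x = z
    · exact Or.inl e
    · exact Or.inr (hl u x y z hx hy hz hxy hyz e)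

/-- If x and y were adjacent, the neighborhood of x would contain the path v, y, w, forcing v ~ w.
-/
theorem not_adj (hl : Γ.IsLocallyCluster) {v w x y : V} (hvw : v ≠ w) (hadj : ¬Γ.Adj v w)
    (hvx : Γ.Adj v x) (hwx : Γ.Adj w x) (hvy : Γ.Adj v y) (hwy : Γ.Adj w y) : ¬Γ.Adj x y :=
  fun e => hadj (hl x v y w hvx.symm e hwx.symm hvy hwy.symm hvw)

end IsLocallyCluster

namespace IsUltrahomogeneous

theorem exists_triangle (h : Γ.IsUltrahomogeneous)
    (ht : ∃ x y z, Γ.Adj x y ∧ Γ.Adj y z ∧ Γ.Adj x z) {a b : V} (hab : Γ.Adj a b) :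
    ∃ c, Γ.Adj a c ∧ Γ.Adj b c := by
  obtain ⟨x, y, z, hxy, hyz, hxz⟩ := ht
  obtain ⟨σ, rfl, rfl⟩ := h.exists_iso_two hxy.ne hab.ne (by simp [hab, hxy])
  exact ⟨σ z, σ.map_adj_iff.2 hxz, σ.map_adj_iff.2 hyz⟩

/-- If a vertex is adjacent to neither end of an edge, then all three have a common neighbor. -/
theorem exists_adj_of_edge (h : Γ.IsUltrahomogeneous) (hc : ¬Γ.IsClusterGraph)
    (hl : Γ.IsLocallyCluster) (ht : ∃ x y z, Γ.Adj x y ∧ Γ.Adj y z ∧ Γ.Adj x z) {v w w' : V}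
    (hvw : v ≠ w) (hvw' : v ≠ w') (hw : ¬Γ.Adj v w) (hw' : ¬Γ.Adj v w') (hww : Γ.Adj w w') :
    ∃ x, Γ.Adj v x ∧ Γ.Adj w x ∧ Γ.Adj w' x := by
  obtain ⟨x, hvx, hwx⟩ := h.exists_common_neighbor hc hvw hw
  obtain ⟨y, hwy, hxy⟩ := h.exists_triangle ht hwx
  have hvy : ¬Γ.Adj v y := fun e => hl.not_adj hvw hw hvx hwx e hwy hxy
  have hvy' : v ≠ y := fun e => hw (e ▸ hwy.symm)
  obtain ⟨σ, e1, e2, e3⟩ := h.exists_iso_three hvw hvy' hwy.ne hvw hvw' hww.ne Iff.rfl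
    (by simp [hw', hvy]) (by simp [hww, hwy])
  exact ⟨σ x, (adj_iff_of_iso σ e1 rfl).2 hvx, (adj_iff_of_iso σ e2 rfl).2 hwx,
    (adj_iff_of_iso σ e3 rfl).2 hxy.symm⟩

/-- If `v` and `w` are not adjacent, then every line through `v` contains a neighbor of `w`. -/
theorem exists_adj_of_line (h : Γ.IsUltrahomogeneous) (hc : ¬Γ.IsClusterGraph)
    (hl : Γ.IsLocallyCluster) (ht : ∃ x y z, Γ.Adj x y ∧ Γ.Adj y z ∧ Γ.Adj x z) {v w y : V}
    (hvw : v ≠ w) (hw : ¬Γ.Adj v w) (hvy : Γ.Adj v y) :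
    ∃ z, Γ.Adj v z ∧ Γ.Adj w z ∧ (y = z ∨ Γ.Adj y z) := by
  by_cases hwy : Γ.Adj w y
  · exact ⟨y, hvy, hwy, Or.inl rfl⟩
  · obtain ⟨z, h1, h2, h3⟩ := h.exists_adj_of_edge hc hl ht hvw.symm
      (fun e => hw (e ▸ hvy)) (fun e => hw e.symm) hwy hvy
    exact ⟨z, h2, h1, Or.inr h3⟩

/-- A neighborhood is a disjoint union of cliques, and at least two of them, since Γ is not a
cluster graph. With v added, these cliques are the lines through v. -/
theorem exists_nonadj_neighbors (h : Γ.IsUltrahomogeneous) (hc : ¬Γ.IsClusterGraph)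
    (hl : Γ.IsLocallyCluster) {v x : V} (hvx : Γ.Adj v x) :
    ∃ a, Γ.Adj v a ∧ x ≠ a ∧ ¬Γ.Adj x a := by
  have hc' := hc
  simp only [IsClusterGraph, not_forall] at hc'
  obtain ⟨p, u, q, hpu, huq, hne, hpq⟩ := hc'
  obtain ⟨σ, rfl⟩ := h.exists_iso_one u v
  by_contra! hcon
  have key : ∀ a, Γ.Adj (σ u) a → x = a ∨ Γ.Adj x a := fun a ha => by
    by_cases e : x = a
    · exact Or.inl e
    · exact Or.inr (hcon a ha e)
  have hp := σ.map_adj_iff.2 hpu.symm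
  have hq := σ.map_adj_iff.2 huq
  rcases hl.trans hp hvx hq ((key _ hp).imp Eq.symm fun e => e.symm) (key _ hq) with e | e
  · exact hne (σ.injective e)
  · exact hpq (σ.map_adj_iff.1 e)

/-- Given three lines through v, a vertex w not adjacent to v admits two vertices w1 and `σ w`, each
distinct from and nonadjacent to v and w. The first has a common neighbor with v and w, the second
has none, although homogeneity makes them conjugate over v and w. -/
theorem not_three_nonadj_neighbors (h : Γ.IsUltrahomogeneous) (hc : ¬Γ.IsClusterGraph)
    (hl : Γ.IsLocallyCluster) (ht : ∃ x y z, Γ.Adj x y ∧ Γ.Adj y z ∧ Γ.Adj x z)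
    {v x1 x2 x3 : V} (h1 : Γ.Adj v x1) (h2 : Γ.Adj v x2) (h3 : Γ.Adj v x3)
    (n12 : ¬(x1 = x2 ∨ Γ.Adj x1 x2)) (n13 : ¬(x1 = x3 ∨ Γ.Adj x1 x3))
    (n23 : ¬(x2 = x3 ∨ Γ.Adj x2 x3)) : False := by
  obtain ⟨w, hvw, hw⟩ := h.exists_not_adj hc v
  obtain ⟨z1, hz1, hwz1, r1⟩ := h.exists_adj_of_line hc hl ht hvw hw h1
  obtain ⟨z2, hz2, hwz2, r2⟩ := h.exists_adj_of_line hc hl ht hvw hw h2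
  obtain ⟨z3, hz3, hwz3, r3⟩ := h.exists_adj_of_line hc hl ht hvw hw h3
  have hsymm : ∀ {a b : V}, (a = b ∨ Γ.Adj a b) → (b = a ∨ Γ.Adj b a) :=
    fun e => e.imp Eq.symm fun e => e.symm
  have hz : ∀ {x y z t : V}, Γ.Adj v x → Γ.Adj v y → Γ.Adj v z → Γ.Adj v t →
      (x = z ∨ Γ.Adj x z) → (y = t ∨ Γ.Adj y t) → ¬(x = y ∨ Γ.Adj x y) →
      ¬(z = t ∨ Γ.Adj z t) := fun hx hy hz ht r s n e =>
    n (hl.trans hx ht hy (hl.trans hx hz ht r e) (hsymm s))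
  have m12 := hz h1 h2 hz1 hz2 r1 r2 n12
  have m13 := hz h1 h3 hz1 hz3 r1 r3 n13
  have m23 := hz h2 h3 hz2 hz3 r2 r3 n23
  obtain ⟨y3, hy3, hzy3⟩ := h.exists_triangle ht hz3
  have k13 := hz hz1 hz3 hz1 hy3 (Or.inl rfl) (Or.inr hzy3) m13
  have k23 := hz hz2 hz3 hz2 hy3 (Or.inl rfl) (Or.inr hzy3) m23
  -- Moving z3 to another point of its line, with v, z1, z2 fixed, moves w to w1, which keeps the
  -- neighbor z1.
  obtain ⟨w1, hvw1, hw1, hw1z1, hwne, hww1⟩ : ∃ w1, v ≠ w1 ∧ ¬Γ.Adj v w1 ∧ Γ.Adj w1 z1 ∧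
      w ≠ w1 ∧ ¬Γ.Adj w w1 := by
    push Not at m12 m13 m23 k13 k23
    obtain ⟨σ, e0, e1, e2, e3⟩ := h.exists_iso_four hz1.ne hz2.ne hz3.ne m12.1 m13.1 m23.1
      hz1.ne hz2.ne hy3.ne m12.1 k13.1 k23.1 (by simp) (by simp) (by simp [hz3, hy3]) (by simp)
      (by simp [m13, k13]) (by simp [m23, k23])
    have a1 := (adj_iff_of_iso σ rfl e1).2 hwz1
    have a2 := (adj_iff_of_iso σ rfl e2).2 hwz2
    have a3 := (adj_iff_of_iso σ rfl e3).2 hwz3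
    refine ⟨σ w, fun e => hvw (σ.injective (e0.trans e)), fun e => hw
      ((adj_iff_of_iso σ e0 rfl).1 e), a1, fun e => ?_, fun e => ?_⟩
    · rw [← e] at a3
      exact hl.not_adj hvw hw hz3 hwz3 hy3 a3 hzy3
    · exact m12.2 (hl w z1 (σ w) z2 hwz1 e hwz2 a1.symm a2 m12.1)
  -- Each common neighbor of v and w is moved along its line through v to a point that is not a
  -- common neighbor.
  have hstar : ∀ x : {x // Γ.Adj v x ∧ Γ.Adj w x}, ∃ y, Γ.Adj v y ∧ Γ.Adj (x : V) y :=
    fun x => h.exists_triangle ht x.2.1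
  choose s hs1 hs2 using hstar
  have hind : ∀ x y : {x // Γ.Adj v x ∧ Γ.Adj w x}, ¬Γ.Adj (x : V) y := fun x y =>
    hl.not_adj hvw hw x.2.1 x.2.2 y.2.1 y.2.2
  have hsinj : ∀ x y, (s x = s y ∨ Γ.Adj (s x) (s y)) → x = y := by
    intro x y e
    by_contra hne
    exact hz x.2.1 y.2.1 (hs1 x) (hs1 y) (Or.inr (hs2 x)) (Or.inr (hs2 y))
      (by rintro (e | e); exacts [hne (Subtype.ext e), hind _ _ e]) e
  obtain ⟨σ, hσ⟩ := h.exists_iso (ι := Option {x // Γ.Adj v x ∧ Γ.Adj w x})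
    (fun i => i.elim v fun x => (x : V)) (fun i => i.elim v s)
    (by
      rintro (_ | x) (_ | y)
      · simp
      · exact iff_of_false y.2.1.ne (hs1 y).ne
      · exact iff_of_false x.2.1.ne' (hs1 x).ne'
      · exact ⟨fun e => congrArg s (Subtype.ext e), fun e => by rw [hsinj x y (Or.inl e)]⟩)
    (by
      rintro (_ | x) (_ | y)
      · simp
      · exact iff_of_true (hs1 y) y.2.1
      · exact iff_of_true (hs1 x).symm x.2.1.symm
      · exact iff_of_false (fun e => e.ne (congrArg s (hsinj _ _ (Or.inr e)))) (hind x y))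
  have hσv : σ v = v := hσ none
  have hvw2 : v ≠ σ w := fun e => hvw (σ.injective (hσv.trans e))
  have hw2 : ¬Γ.Adj v (σ w) := fun e => hw ((adj_iff_of_iso σ hσv rfl).1 e)
  have hdisj : ∀ z, Γ.Adj v z → Γ.Adj w z → ¬Γ.Adj (σ w) z := by
    intro z hvz hwz hwz2
    have e1 := (adj_iff_of_iso σ hσv (σ.apply_symm_apply z)).1 hvz
    have e2 := (adj_iff_of_iso σ rfl (σ.apply_symm_apply z)).1 hwz2
    have e3 : σ (σ.symm z) = s ⟨_, e1, e2⟩ := hσ (some ⟨_, e1, e2⟩)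
    have e4 := hs2 ⟨_, e1, e2⟩
    rw [← e3, σ.apply_symm_apply] at e4
    exact hind ⟨_, e1, e2⟩ ⟨z, hvz, hwz⟩ e4
  have hne2 : w ≠ σ w := fun e => hdisj z1 hz1 hwz1 (e ▸ hwz1)
  have hww2 : ¬Γ.Adj w (σ w) := by
    intro e
    obtain ⟨x, e1, e2, e3⟩ := h.exists_adj_of_edge hc hl ht hvw hvw2 hw hw2 e
    exact hdisj x e1 e2 e3
  obtain ⟨τ, e1, e2, e3⟩ := h.exists_iso_three hvw hvw1 hwne hvw hvw2 hne2 Iff.rfl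
    (by simp [hw1, hw2]) (by simp [hww1, hww2])
  exact hdisj (τ z1) ((adj_iff_of_iso τ e1 rfl).2 hz1) ((adj_iff_of_iso τ e2 rfl).2 hwz1)
    ((adj_iff_of_iso τ e3 rfl).2 hw1z1)

/-- Two nonadjacent vertices have exactly two common neighbors, which are not adjacent. -/
theorem exists_second_common_neighbor (h : Γ.IsUltrahomogeneous) (hc : ¬Γ.IsClusterGraph)
    (hl : Γ.IsLocallyCluster) (ht : ∃ x y z, Γ.Adj x y ∧ Γ.Adj y z ∧ Γ.Adj x z) {a b c : V}
    (hab : a ≠ b) (hadj : ¬Γ.Adj a b) (hac : Γ.Adj a c) (hbc : Γ.Adj b c) :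
    ∃ e, Γ.Adj a e ∧ Γ.Adj b e ∧ c ≠ e ∧ ¬Γ.Adj c e ∧
      ∀ d, Γ.Adj a d → Γ.Adj b d → d = c ∨ d = e := by
  obtain ⟨y, hay, hcy, hcy'⟩ := h.exists_nonadj_neighbors hc hl hac
  obtain ⟨e, hae, hbe, hye⟩ := h.exists_adj_of_line hc hl ht hab hadj hay
  have hce : c ≠ e := by
    rintro rfl
    rcases hye with e | e
    exacts [hcy e.symm, hcy' e.symm]
  have hce' : ¬Γ.Adj c e := hl.not_adj hab hadj hac hbc hae hbe
  refine ⟨e, hae, hbe, hce, hce', fun d had hbd => ?_⟩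
  by_contra! hd
  exact h.not_three_nonadj_neighbors hc hl ht had hac hae
    (not_or.2 ⟨hd.1, hl.not_adj hab hadj had hbd hac hbc⟩)
    (not_or.2 ⟨hd.2, hl.not_adj hab hadj had hbd hae hbe⟩) (not_or.2 ⟨hce, hce'⟩)

/-- Suppose the line through v and x has a further point y' besides y. For a and b on another line
through v, let e be the second common neighbor of y' and a. An automorphism fixing x, y, a and
taking b to e moves v to another point of the line vx that is still adjacent to a, so x ~ a, which
is false. -/
theorem eq_of_triangle (h : Γ.IsUltrahomogeneous) (hc : ¬Γ.IsClusterGraph)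
    (hl : Γ.IsLocallyCluster) (ht : ∃ x y z, Γ.Adj x y ∧ Γ.Adj y z ∧ Γ.Adj x z) {v x y y' : V}
    (hvx : Γ.Adj v x) (hvy : Γ.Adj v y) (hxy : Γ.Adj x y) (hvy' : Γ.Adj v y')
    (hxy' : Γ.Adj x y') : y = y' := by
  by_contra hne
  have hyy : Γ.Adj y y' := hl v y x y' hvy hvx hvy' hxy.symm hxy' hne
  obtain ⟨a, hva, hxa, hxa'⟩ := h.exists_nonadj_neighbors hc hl hvx
  obtain ⟨b, hvb, hab⟩ := h.exists_triangle ht hva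
  have hR : ∀ {p q}, Γ.Adj v p → Γ.Adj v q → (x = p ∨ Γ.Adj x p) → (a = q ∨ Γ.Adj a q) →
      ¬(p = q ∨ Γ.Adj p q) := fun hp hq r s e =>
    (not_or.2 ⟨hxa, hxa'⟩) (hl.trans hvx hq hva (hl.trans hvx hp hq r e)
      (s.imp Eq.symm fun e => e.symm))
  have nya := not_or.1 (hR hvy hva (Or.inr hxy) (Or.inl rfl))
  have nya' := not_or.1 (hR hvy' hva (Or.inr hxy') (Or.inl rfl))
  have nxb := not_or.1 (hR hvx hvb (Or.inl rfl) (Or.inr hab))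
  have nyb := not_or.1 (hR hvy hvb (Or.inr hxy) (Or.inr hab))
  obtain ⟨e, hye, hae, hve, hve', -⟩ := h.exists_second_common_neighbor hc hl ht nya'.1 nya'.2
    hvy'.symm hva.symm
  have hxe : ¬Γ.Adj x e := fun e' => hl.not_adj hve hve' hvy' hye.symm hvx e'.symm hxy'.symm
  have hye' : ¬Γ.Adj y e := fun e' => hl.not_adj hve hve' hvy' hye.symm hvy e'.symm hyy.symm
  obtain ⟨σ, e1, e2, e3, e4⟩ := h.exists_iso_four hxy.ne hxa nxb.1 nya.1 nyb.1 hab.ne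
    hxy.ne hxa (fun e' => hve' (e' ▸ hvx) : x ≠ e) nya.1 (fun e' => hve' (e' ▸ hvy) : y ≠ e)
    hae.ne Iff.rfl Iff.rfl (by simp [hxe, nxb]) Iff.rfl (by simp [hye', nyb])
    (by simp [hab, hae])
  have f1 := (adj_iff_of_iso σ rfl e1).2 hvx
  have f2 := (adj_iff_of_iso σ rfl e2).2 hvy
  have f3 := (adj_iff_of_iso σ rfl e3).2 hva
  have f4 := (adj_iff_of_iso σ rfl e4).2 hvb
  have hne2 : v ≠ σ v := fun e' => hve' (e' ▸ f4)
  have f5 : Γ.Adj v (σ v) := hl x v y (σ v) hvx.symm hxy f1.symm hvy f2.symm hne2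
  exact hxa' (hl v x (σ v) a hvx f5 hva f1.symm f3 hxa)

theorem nonempty_iso_rookGraph (h : Γ.IsUltrahomogeneous) (hc : ¬Γ.IsClusterGraph)
    (hl : Γ.IsLocallyCluster) (ht : ∃ x y z, Γ.Adj x y ∧ Γ.Adj y z ∧ Γ.Adj x z) :
    Nonempty (Γ ≃g rookGraph) := by
  have hc' := hc
  simp only [IsClusterGraph, not_forall] at hc'
  obtain ⟨p, v, q, hvp, hvq, hpq', hpq⟩ := hc'
  replace hvp := hvp.symm
  obtain ⟨p', hvp', hpp⟩ := h.exists_triangle ht hvp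
  obtain ⟨q', hvq', hqq⟩ := h.exists_triangle ht hvq
  have hR : ∀ {a b}, Γ.Adj v a → Γ.Adj v b → (p = a ∨ Γ.Adj p a) → (q = b ∨ Γ.Adj q b) →
      a ≠ b ∧ ¬Γ.Adj a b := fun ha hb r s => not_or.1 fun e =>
    (not_or.2 ⟨hpq', hpq⟩) (hl.trans hvp hb hvq (hl.trans hvp ha hb r e)
      (s.imp Eq.symm fun e => e.symm))
  have npq' := hR hvp hvq' (Or.inl rfl) (Or.inr hqq)
  have np'q := hR hvp' hvq (Or.inr hpp) (Or.inl rfl)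
  have np'q' := hR hvp' hvq' (Or.inr hpp) (Or.inr hqq)
  have hline : ∀ x, Γ.Adj v x → (x = p ∨ x = p') ∨ (x = q ∨ x = q') := by
    intro x hx
    by_cases e1 : p = x ∨ Γ.Adj p x
    · exact Or.inl (e1.imp Eq.symm fun e => h.eq_of_triangle hc hl ht hvp hx e hvp' hpp)
    by_cases e2 : q = x ∨ Γ.Adj q x
    · exact Or.inr (e2.imp Eq.symm fun e => h.eq_of_triangle hc hl ht hvq hx e hvq' hqq)
    exact (h.not_three_nonadj_neighbors hc hl ht hvp hvq hx (not_or.2 ⟨hpq', hpq⟩) e1 e2).elim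
  have hsecond : ∀ {a b}, Γ.Adj v a → Γ.Adj v b → a ≠ b ∧ ¬Γ.Adj a b →
      ∃ e, Γ.Adj a e ∧ Γ.Adj b e ∧ v ≠ e ∧ ¬Γ.Adj v e ∧
        ∀ d, Γ.Adj a d → Γ.Adj b d → d = v ∨ d = e := fun ha hb n =>
    h.exists_second_common_neighbor hc hl ht n.1 n.2 ha.symm hb.symm
  obtain ⟨w11, p11, q11, v11, n11, u11⟩ := hsecond hvp hvq ⟨hpq', hpq⟩
  obtain ⟨w12, p12, q12, v12, n12, u12⟩ := hsecond hvp hvq' npq'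
  obtain ⟨w21, p21, q21, v21, n21, u21⟩ := hsecond hvp' hvq np'q
  obtain ⟨w22, p22, q22, v22, n22, u22⟩ := hsecond hvp' hvq' np'q'
  -- The vertices v, w, w' are neighbors of a, which lies on at most two lines; v is on neither line
  -- aw nor aw', so w ~ w'.
  have hadj : ∀ {a b b' w w'}, Γ.Adj v a → Γ.Adj v b → Γ.Adj v b' → Γ.Adj b b' → v ≠ w →
      ¬Γ.Adj v w → v ≠ w' → ¬Γ.Adj v w' → Γ.Adj a w → Γ.Adj b w → Γ.Adj a w' → Γ.Adj b' w' →
      Γ.Adj w w' := by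
    intro a b b' w w' ha hb hb' hbb h1 h2 h3 h4 h5 h6 h7 h8
    by_contra hcon
    refine h.not_three_nonadj_neighbors hc hl ht ha.symm h5 h7 (not_or.2 ⟨h1, h2⟩)
      (not_or.2 ⟨h3, h4⟩) (not_or.2 ⟨?_, hcon⟩)
    rintro rfl
    exact hl.not_adj h1 h2 hb h6.symm hb' h8.symm hbb
  have hno : ∀ {a a' w}, Γ.Adj v a → Γ.Adj v a' → Γ.Adj a a' → v ≠ w → ¬Γ.Adj v w →
      Γ.Adj a w → ¬Γ.Adj a' w := fun ha ha' haa h1 h2 h3 h4 =>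
    hl.not_adj h1 h2 ha h3.symm ha' h4.symm haa
  have a1 := hadj hvp hvq hvq' hqq v11 n11 v12 n12 p11 q11 p12 q12
  have a2 := hadj hvp' hvq hvq' hqq v21 n21 v22 n22 p21 q21 p22 q22
  have a3 := hadj hvq hvp hvp' hpp v11 n11 v21 n21 q11 p11 q21 p21
  have a4 := hadj hvq' hvp hvp' hpp v12 n12 v22 n22 q12 p12 q22 p22
  have b1 := hno hvp hvp' hpp v11 n11 p11
  have b2 := hno hvp hvp' hpp v12 n12 p12
  have b3 := hno hvp' hvp hpp.symm v21 n21 p21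
  have b4 := hno hvp' hvp hpp.symm v22 n22 p22
  have b5 := hno hvq hvq' hqq v11 n11 q11
  have b6 := hno hvq hvq' hqq v21 n21 q21
  have b7 := hno hvq' hvq hqq.symm v12 n12 q12
  have b8 := hno hvq' hvq hqq.symm v22 n22 q22
  -- An edge here would share a neighbor with v, but none of p, p', q, q' is adjacent to both ends.
  have c1 : ¬Γ.Adj w11 w22 := by
    intro e
    obtain ⟨x, hx, e1, e2⟩ := h.exists_adj_of_edge hc hl ht v11 v22 n11 n22 e
    rcases hline x hx with (rfl | rfl) | (rfl | rfl)
    exacts [b4 e2.symm, b1 e1.symm, b8 e2.symm, b5 e1.symm]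
  have c2 : ¬Γ.Adj w12 w21 := by
    intro e
    obtain ⟨x, hx, e1, e2⟩ := h.exists_adj_of_edge hc hl ht v12 v21 n12 n21 e
    rcases hline x hx with (rfl | rfl) | (rfl | rfl)
    exacts [b3 e2.symm, b2 e1.symm, b7 e1.symm, b6 e2.symm]
  refine nonempty_iso_of_surjective
    (fun i : Fin 3 × Fin 3 => ![![v, q, q'], ![p, w11, w12], ![p', w21, w22]] i.1 i.2) ?_ ?_
    (by decide)
  · intro u
    by_cases huv : v = u
    · exact ⟨(0, 0), huv⟩
    by_cases hu : Γ.Adj v u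
    · rcases hline u hu with (rfl | rfl) | (rfl | rfl)
      exacts [⟨(1, 0), rfl⟩, ⟨(2, 0), rfl⟩, ⟨(0, 1), rfl⟩, ⟨(0, 2), rfl⟩]
    obtain ⟨z, hz, huz, rz⟩ := h.exists_adj_of_line hc hl ht huv hu hvp
    obtain ⟨t, hvt, hut, rt⟩ := h.exists_adj_of_line hc hl ht huv hu hvq
    replace rz : z = p ∨ z = p' := rz.imp Eq.symm fun e => h.eq_of_triangle hc hl ht hvp hz e hvp' hpp
    replace rt : t = q ∨ t = q' :=
      rt.imp Eq.symm fun e => h.eq_of_triangle hc hl ht hvq hvt e hvq' hqq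
    rcases rz with rfl | rfl <;> rcases rt with rfl | rfl
    · exact ⟨(1, 1), (((u11 u huz.symm hut.symm).resolve_left (Ne.symm huv))).symm⟩
    · exact ⟨(1, 2), (((u12 u huz.symm hut.symm).resolve_left (Ne.symm huv))).symm⟩
    · exact ⟨(2, 1), (((u21 u huz.symm hut.symm).resolve_left (Ne.symm huv))).symm⟩
    · exact ⟨(2, 2), (((u22 u huz.symm hut.symm).resolve_left (Ne.symm huv))).symm⟩
  · have s : ∀ {a b}, ¬Γ.Adj a b → ¬Γ.Adj b a := fun e e' => e e'.symm
    simp [Prod.forall, Fin.forall_fin_succ, rookGraph,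
      hvp, hvp', hvq, hvq', hpp, hqq, p11, q11, p12, q12, p21, q21, p22, q22, a1, a2, a3, a4,
      hvp.symm, hvp'.symm, hvq.symm, hvq'.symm, hpp.symm, hqq.symm, p11.symm, q11.symm, p12.symm,
      q12.symm, p21.symm, q21.symm, p22.symm, q22.symm, a1.symm, a2.symm, a3.symm, a4.symm, hpq,
      npq'.2, np'q.2, np'q'.2, n11, n12, n21, n22, b1, b2, b3, b4, b5, b6, b7, b8, c1, c2, s hpq,
      s npq'.2, s np'q.2, s np'q'.2, s n11, s n12, s n21, s n22, s b1, s b2, s b3, s b4, s b5,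
      s b6, s b7, s b8, s c1, s c2]

end IsUltrahomogeneous

end LocallyCluster

end SimpleGraph

namespace SimpleGraph

/-! ### Ultrahomogeneity of the Gardiner graphs -/

section Examples

variable {W : Type*} {Δ : SimpleGraph W}

/-- A criterion for ultrahomogeneity: the stabilizer of two points is generated by one
automorphism `τ`, and the types over these two points are its orbits. -/
theorem isUltrahomogeneous_of_flip
    (htrans : ∀ a b : W, ∃ σ : Δ ≃g Δ, σ a = b)
    (hstab : ∀ a b c : W, a ≠ b → a ≠ c → (Δ.Adj a b ↔ Δ.Adj a c) →
      ∃ σ : Δ ≃g Δ, σ a = a ∧ σ b = c)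
    (hflip : ∀ a b : W, a ≠ b → ∃ τ : Δ ≃g Δ, τ a = a ∧ τ b = b ∧
      (∀ x y, x ≠ a → x ≠ b → y ≠ a → y ≠ b → (Δ.Adj a x ↔ Δ.Adj a y) →
        (Δ.Adj b x ↔ Δ.Adj b y) → y = x ∨ y = τ x) ∧
      ∀ c d, τ c ≠ c → τ d ≠ d → c ≠ d → τ c ≠ d → ¬(Δ.Adj c d ↔ Δ.Adj (τ c) d)) :
    Δ.IsUltrahomogeneous := by
  intro S f hf hadj
  by_cases hS : S.Subsingleton
  · rcases hS.eq_empty_or_singleton with rfl | ⟨a, rfl⟩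
    · exact ⟨RelIso.refl _, by simp⟩
    · obtain ⟨σ, hσ⟩ := htrans a (f a)
      exact ⟨σ, by simpa using hσ⟩
  rw [Set.not_subsingleton_iff] at hS
  obtain ⟨a, ha, b, hb, hab⟩ := hS
  obtain ⟨σ, hσa, hσb⟩ : ∃ σ : Δ ≃g Δ, σ a = f a ∧ σ b = f b := by
    obtain ⟨σ1, h1⟩ := htrans a (f a)
    have hne : f a ≠ f b := fun e => hab (hf ha hb e)
    obtain ⟨σ2, h2, h3⟩ := hstab (f a) (σ1 b) (f b)
      (fun e => hab (σ1.injective (h1.trans e))) hne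
      (((hadj a ha b hb).trans (adj_iff_of_iso σ1 h1 rfl).symm).symm)
    exact ⟨σ1.trans σ2, by simp [h1, h2], by simp [h3]⟩
  have hg : ∀ x, f x = σ (σ.symm (f x)) := fun x => (σ.apply_symm_apply _).symm
  set g : W → W := fun x => σ.symm (f x) with hgdef
  have hginj : Set.InjOn g S := fun x hx y hy e => hf hx hy (σ.symm.injective e)
  have hgadj : ∀ x ∈ S, ∀ y ∈ S, (Δ.Adj (g x) (g y) ↔ Δ.Adj x y) := fun x hx y hy =>
    σ.symm.map_adj_iff.trans (hadj x hx y hy)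
  have hga : g a = a := by simp [hgdef, ← hσa]
  have hgb : g b = b := by simp [hgdef, ← hσb]
  obtain ⟨τ, hτa, hτb, hτ, hτ'⟩ := hflip a b hab
  -- After correction by σ the partial map fixes a and b, so each point is fixed or moved as by τ.
  have hall : ∀ x ∈ S, g x = x ∨ g x = τ x := by
    intro x hx
    by_cases h1 : x = a
    · exact Or.inl (h1 ▸ hga)
    by_cases h2 : x = b
    · exact Or.inl (h2 ▸ hgb)
    refine hτ x (g x) h1 h2 (fun e => h1 (hginj hx ha (e.trans hga.symm)))
      (fun e => h2 (hginj hx hb (e.trans hgb.symm))) ?_ ?_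
    · have := hgadj a ha x hx
      rw [hga] at this
      exact this.symm
    · have := hgadj b hb x hx
      rw [hgb] at this
      exact this.symm
  by_cases hid : ∀ x ∈ S, g x = x
  · exact ⟨σ, fun x hx => by rw [hg x]; exact congrArg σ (hid x hx).symm⟩
  push Not at hid
  obtain ⟨c, hcS, hc⟩ := hid
  have hτc := (hall c hcS).resolve_left hc
  refine ⟨τ.trans σ, fun x hx => ?_⟩
  -- The choice is uniform: moving c by τ while fixing a point x that τ moves would change the
  -- adjacency of c and x.
  have hx' : g x = τ x := by
    by_contra hx'
    have hgx := (hall x hx).resolve_right hx'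
    refine hτ' c x (hτc ▸ hc) (fun e => hx' (hgx.trans e.symm)) ?_ ?_ ?_
    · rintro rfl
      exact hx' hτc
    · rw [← hτc, ← hgx]
      intro e
      have := hginj hcS hx e
      exact hc (this ▸ hgx)
    · have := hgadj c hcS x hx
      rw [hgx, hτc] at this
      exact this.symm
  rw [hg x]
  exact congrArg σ hx'.symm

theorem exists_iso_of_injective [Finite W] {f : W → W} (hf : Function.Injective f)
    (hadj : ∀ a b, Δ.Adj (f a) (f b) ↔ Δ.Adj a b) : ∃ σ : Δ ≃g Δ, ∀ x, σ x = f x :=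
  ⟨⟨Equiv.ofBijective f (Finite.injective_iff_bijective.1 hf), by intro a b; exact hadj a b⟩,
    fun _ => rfl⟩

theorem isUltrahomogeneous_cycleGraph_five : (cycleGraph 5).IsUltrahomogeneous := by
  have haut : ∀ (u : Bool) (p : Fin 5), ∃ σ : cycleGraph 5 ≃g cycleGraph 5,
      ∀ x, σ x = (if u then -x else x) + p := fun u p =>
    exists_iso_of_injective (f := fun x => (if u then -x else x) + p)
      (by revert u p; decide) (by revert u p; decide)
  refine isUltrahomogeneous_of_flip (fun a b => ?_) (fun a b c hab hac h => ?_)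
    (fun a b hab => ⟨RelIso.refl _, rfl, rfl, ?_, by simp⟩)
  · obtain ⟨σ, hσ⟩ := haut false (b - a)
    exact ⟨σ, by simp [hσ]⟩
  · have key : ∀ a b c : Fin 5, a ≠ b → a ≠ c → ((cycleGraph 5).Adj a b ↔ (cycleGraph 5).Adj a c) →
        ∃ (u : Bool) (p : Fin 5), (if u then -a else a) + p = a ∧ (if u then -b else b) + p = c := by
      decide
    obtain ⟨u, p, h1, h2⟩ := key a b c hab hac h
    obtain ⟨σ, hσ⟩ := haut u p
    exact ⟨σ, (hσ a).trans h1, (hσ b).trans h2⟩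
  · have key : ∀ a b : Fin 5, a ≠ b → ∀ x y, x ≠ a → x ≠ b → y ≠ a → y ≠ b →
        ((cycleGraph 5).Adj a x ↔ (cycleGraph 5).Adj a y) →
        ((cycleGraph 5).Adj b x ↔ (cycleGraph 5).Adj b y) → y = x := by decide
    exact fun x y h1 h2 h3 h4 h5 h6 => Or.inl (key a b hab x y h1 h2 h3 h4 h5 h6)

/-- The affine automorphisms of the rook's graph. -/
def rookMap (t : Bool × Bool × Bool × Fin 3 × Fin 3) (x : Fin 3 × Fin 3) : Fin 3 × Fin 3 :=
  let y := if t.1 then x.swap else x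
  ((if t.2.1 then -y.1 else y.1) + t.2.2.2.1, (if t.2.2.1 then -y.2 else y.2) + t.2.2.2.2)

set_option synthInstance.maxHeartbeats 400000 in
set_option synthInstance.maxSize 2000 in
theorem isUltrahomogeneous_rookGraph : rookGraph.IsUltrahomogeneous := by
  -- With rows and columns read modulo 3, negations and translations give all permutations of each
  -- coordinate, and `swap` exchanges the coordinates.
  have haut : ∀ t, ∃ σ : rookGraph ≃g rookGraph, ∀ x, σ x = rookMap t x := fun t =>
    exists_iso_of_injective (f := rookMap t)
      (by revert t; decide +kernel) (by revert t; decide +kernel)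
  refine isUltrahomogeneous_of_flip (fun a b => ?_) (fun a b c hab hac h => ?_)
    (fun a b hab => ?_)
  · obtain ⟨σ, hσ⟩ := haut (false, false, false, b.1 - a.1, b.2 - a.2)
    exact ⟨σ, by simp [hσ, rookMap]⟩
  · have key : ∀ a b c : Fin 3 × Fin 3, a ≠ b → a ≠ c → (rookGraph.Adj a b ↔ rookGraph.Adj a c) →
        ∃ t, rookMap t a = a ∧ rookMap t b = c := by decide +kernel
    obtain ⟨t, h1, h2⟩ := key a b c hab hac h
    obtain ⟨σ, hσ⟩ := haut t
    exact ⟨σ, (hσ a).trans h1, (hσ b).trans h2⟩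
  · have key : ∀ a b : Fin 3 × Fin 3, a ≠ b → ∃ t, rookMap t a = a ∧ rookMap t b = b ∧
        (∀ x y, x ≠ a → x ≠ b → y ≠ a → y ≠ b → (rookGraph.Adj a x ↔ rookGraph.Adj a y) →
          (rookGraph.Adj b x ↔ rookGraph.Adj b y) → y = x ∨ y = rookMap t x) ∧
        ∀ c d, rookMap t c ≠ c → rookMap t d ≠ d → c ≠ d → rookMap t c ≠ d →
          ¬(rookGraph.Adj c d ↔ rookGraph.Adj (rookMap t c) d) := by decide +kernel
    obtain ⟨t, h⟩ := key a b hab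
    obtain ⟨σ, hσ⟩ := haut t
    exact ⟨σ, by simpa only [hσ] using h⟩

/-- Doubling modulo 5 exchanges the distances 1 and 2. -/
theorem nonempty_compl_cycleGraph_five_iso : Nonempty ((cycleGraph 5)ᶜ ≃g cycleGraph 5) :=
  nonempty_iso_of_surjective (fun i => 2 * i) (by decide)
    (by simp only [compl_adj]; decide) (by decide)

/-- Modulo 3, the map (a, b) ↦ (a + b, a - b) turns rows and columns into the two families of
diagonals. -/
theorem nonempty_compl_rookGraph_iso : Nonempty (rookGraphᶜ ≃g rookGraph) :=
  nonempty_iso_of_surjective (fun i => (i.1 + i.2, i.1 - i.2)) (by decide)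
    (by simp only [compl_adj]; decide +kernel) (by decide +kernel)

theorem nonempty_rookGraph_iso_lineGraph :
    Nonempty ((completeBipartiteGraph (Fin 3) (Fin 3)).lineGraph ≃g rookGraph) := by
  refine nonempty_iso_of_surjective
    (fun i => ⟨s(Sum.inl i.1, Sum.inr i.2), by simp⟩) ?_ ?_ (by decide +kernel)
  · rintro ⟨e, he⟩
    induction e using Sym2.ind with
    | _ x y =>
      rcases x with x | x <;> rcases y with y | y
      · simp at he
      · exact ⟨(x, y), rfl⟩
      · exact ⟨(y, x), Subtype.ext Sym2.eq_swap⟩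
      · simp at he
  · rintro ⟨i, j⟩ ⟨k, l⟩
    rw [lineGraph_adj_iff_exists]
    simp [rookGraph, Subtype.ext_iff, or_and_right, exists_or]

/-- Tuples with the same equality pattern are conjugate under permutations. -/
theorem exists_perm_of_eq_iff_eq {α ι : Type*} [Finite α] (a b : ι → α)
    (h : ∀ i j, a i = a j ↔ b i = b j) : ∃ π : Equiv.Perm α, ∀ i, π (a i) = b i := by
  classical
  have := Fintype.ofFinite α
  let e : {x // x ∈ Set.range a} ≃ {x // x ∈ Set.range b} := Equiv.ofBijective
    (fun x => ⟨b x.2.choose, Set.mem_range_self _⟩) (by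
      constructor
      · rintro x y hxy
        have := (h _ _).2 (congrArg Subtype.val hxy)
        exact Subtype.ext (x.2.choose_spec.symm.trans (this.trans y.2.choose_spec))
      · rintro ⟨_, i, rfl⟩
        have hm : a i ∈ Set.range a := ⟨i, rfl⟩
        exact ⟨⟨a i, hm⟩, Subtype.ext ((h _ _).1 hm.choose_spec)⟩)
  refine ⟨e.extendSubtype, fun i => ?_⟩
  have hm : a i ∈ Set.range a := ⟨i, rfl⟩
  rw [Equiv.extendSubtype_apply_of_mem e (a i) hm]
  exact (h _ _).1 hm.choose_spec

theorem isUltrahomogeneous_disjointCompleteGraphs (k n : ℕ) :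
    (disjointCompleteGraphs k n).IsUltrahomogeneous := by
  intro S f hf hadj
  -- The partial map respects the partition into copies, so it is extended by a permutation ρ of the
  -- copies and a permutation τ i inside each.
  have h1 : ∀ i j : S, (i : Fin k × Fin n).1 = (j : Fin k × Fin n).1 ↔ (f i).1 = (f j).1 := by
    intro i j
    by_cases e : i = j
    · simp [e]
    have hne : (i : Fin k × Fin n) ≠ j := fun h => e (Subtype.ext h)
    have hne' : f i ≠ f j := fun h => hne (hf i.2 j.2 h)
    have := hadj i i.2 j j.2
    simp only [disjointCompleteGraphs] at this
    rw [ne_eq, Prod.ext_iff] at hne hne'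
    tauto
  obtain ⟨ρ, hρ⟩ := exists_perm_of_eq_iff_eq _ _ h1
  have h2 : ∀ i, ∃ τ : Equiv.Perm (Fin n), ∀ x ∈ S, x.1 = i → τ x.2 = (f x).2 := by
    intro i
    obtain ⟨τ, hτ⟩ := exists_perm_of_eq_iff_eq
      (fun x : {x : S // (x : Fin k × Fin n).1 = i} => (x : Fin k × Fin n).2)
      (fun x => (f x).2) (by
        rintro ⟨x, hx⟩ ⟨y, hy⟩
        have e := (h1 x y).1 (hx.trans hy.symm)
        constructor
        · intro e'
          have : x = y := Subtype.ext (Prod.ext (hx.trans hy.symm) e')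
          simp [this]
        · intro e'
          have := hf x.2 y.2 (Prod.ext e e')
          simp [this])
    exact ⟨τ, fun x hx hi => hτ ⟨⟨x, hx⟩, hi⟩⟩
  choose τ hτ using h2
  refine ⟨⟨Equiv.prodShear ρ τ, ?_⟩, fun x hx => Prod.ext (hρ ⟨x, hx⟩) (hτ _ x hx rfl)⟩
  intro a b
  simp only [disjointCompleteGraphs, Equiv.prodShear_apply, ρ.injective.eq_iff]
  constructor
  · rintro ⟨e1, e2⟩
    exact ⟨e1, fun e => e2 (by rw [e1, e])⟩
  · rintro ⟨e1, e2⟩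
    exact ⟨e1, fun e => e2 (by rw [e1] at e; exact (τ _).injective e)⟩

/-- The complement of an isomorphism. -/
theorem nonempty_iso_compl {V : Type*} {Γ : SimpleGraph V} (e : Γ ≃g Δ) : Nonempty (Γᶜ ≃g Δᶜ) :=
  ⟨⟨e.toEquiv, by
    intro a b
    simpa [compl_adj] using fun _ => not_congr e.map_adj_iff⟩⟩

theorem nonempty_completeMultipartiteGraph_iso (k n : ℕ) :
    Nonempty ((disjointCompleteGraphs k n)ᶜ ≃g
      completeMultipartiteGraph fun _ : Fin k => Fin n) := by
  refine ⟨⟨(Equiv.sigmaEquivProd (Fin k) (Fin n)).symm, ?_⟩⟩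
  rintro ⟨a, b⟩ ⟨c, d⟩
  simp [disjointCompleteGraphs, compl_adj]
  tauto

end Examples

end SimpleGraph

theorem IsGardinerGraph.isUltrahomogeneous {V : Type*} {Γ : SimpleGraph V}
    (h : IsGardinerGraph Γ) : Γ.IsUltrahomogeneous := by
  rcases h with ⟨k, n, -, -, ⟨e⟩⟩ | ⟨k, n, -, -, ⟨e⟩⟩ | ⟨⟨e⟩⟩ | ⟨⟨e⟩⟩
  · exact (SimpleGraph.isUltrahomogeneous_disjointCompleteGraphs k n).of_iso e
  · obtain ⟨e'⟩ := SimpleGraph.nonempty_completeMultipartiteGraph_iso k n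
    exact (SimpleGraph.isUltrahomogeneous_disjointCompleteGraphs k n).compl.of_iso (e.trans e'.symm)
  · exact SimpleGraph.isUltrahomogeneous_cycleGraph_five.of_iso e
  · obtain ⟨e'⟩ := SimpleGraph.nonempty_rookGraph_iso_lineGraph
    exact SimpleGraph.isUltrahomogeneous_rookGraph.of_iso (e.trans e')

namespace SimpleGraph

/-! ### The induction for Gardiner's theorem -/

section Classification

/-- The hypothesis `hN` is what induction gives for one neighborhood. Odd degree arises when that
neighborhood is the 5-cycle or the rook's graph, with 5 or 9 vertices. -/
theorem IsUltrahomogeneous.iso_or_odd {V : Type*} [Finite V] {Γ : SimpleGraph V}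
    (h : Γ.IsUltrahomogeneous) (hc : ¬Γ.IsClusterGraph) (hcc : ¬Γᶜ.IsClusterGraph) (v : V)
    (hN : (Γ.induce (Γ.neighborSet v)).IsClusterGraph ∨
      (Γ.induce (Γ.neighborSet v))ᶜ.IsClusterGraph ∨
      Nonempty (Γ.induce (Γ.neighborSet v) ≃g cycleGraph 5) ∨
      Nonempty (Γ.induce (Γ.neighborSet v) ≃g rookGraph)) :
    Nonempty (Γ ≃g cycleGraph 5) ∨ Nonempty (Γ ≃g rookGraph) ∨
      Odd (Nat.card (Γ.neighborSet v)) := by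
  by_cases hcl : (Γ.induce (Γ.neighborSet v)).IsClusterGraph
  · by_cases ht : ∃ x y z, Γ.Adj x y ∧ Γ.Adj y z ∧ Γ.Adj x z
    · exact Or.inr (Or.inl (h.nonempty_iso_rookGraph hc
        ((h.isClusterGraph_neighborSet_iff v).1 hcl) ht))
    · push Not at ht
      exact Or.inl (h.nonempty_iso_cycleGraph_of_triangleFree hc hcc ht)
  rcases hN with hN | hN | ⟨⟨e⟩⟩ | ⟨⟨e⟩⟩
  · exact absurd hN hcl
  · exact absurd (h.isClusterGraph_compl_of_neighborSet v hN hcl) hcc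
  · rw [Nat.card_congr e.toEquiv, Nat.card_eq_fintype_card]
    exact Or.inr (Or.inr (by decide))
  · rw [Nat.card_congr e.toEquiv, Nat.card_eq_fintype_card]
    exact Or.inr (Or.inr (by decide))

/-- The order is 1 plus the two odd degrees, hence odd, while a regular graph of odd degree has even
order. -/
theorem IsUltrahomogeneous.not_odd_odd {V : Type*} [Finite V] {Γ : SimpleGraph V}
    (h : Γ.IsUltrahomogeneous) (v : V) (h1 : Odd (Nat.card (Γ.neighborSet v)))
    (h2 : Odd (Nat.card (Γᶜ.neighborSet v))) : False := by
  classical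
  have := Fintype.ofFinite V
  rw [Nat.card_eq_fintype_card, card_neighborSet_eq_degree] at h1 h2
  have hdeg : ∀ w, Odd (Γ.degree w) := fun w => by
    obtain ⟨σ, rfl⟩ := h.exists_iso_one v w
    rwa [σ.degree_eq]
  have he := Γ.even_card_odd_degree_vertices
  rw [Finset.filter_true_of_mem fun w _ => hdeg w, Finset.card_univ] at he
  rw [degree_compl] at h2
  have hlt := Γ.degree_lt_card_verts v
  grind

/-- The case distinction behind Gardiner's theorem on finite ultrahomogeneous graphs. -/
theorem IsUltrahomogeneous.classification (m : ℕ) : ∀ {V : Type u} [Finite V]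
    {Γ : SimpleGraph V}, Nat.card V = m → Γ.IsUltrahomogeneous →
      Γ.IsClusterGraph ∨ Γᶜ.IsClusterGraph ∨ Nonempty (Γ ≃g cycleGraph 5) ∨
        Nonempty (Γ ≃g rookGraph) := by
  induction m using Nat.strong_induction_on with
  | _ m ih =>
    intro V _ Γ hm h
    by_cases hc : Γ.IsClusterGraph
    · exact Or.inl hc
    by_cases hcc : Γᶜ.IsClusterGraph
    · exact Or.inr (Or.inl hcc)
    have hc' := hc
    simp only [IsClusterGraph, not_forall] at hc'
    obtain ⟨v, -⟩ := hc'
    have hlt : ∀ Δ : SimpleGraph V, Nat.card (Δ.neighborSet v) < m := by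
      intro Δ
      rw [← hm]
      exact Finite.card_subtype_lt (x := v) (by simp)
    have hloc : ∀ Δ : SimpleGraph V, Δ.IsUltrahomogeneous → _ := fun Δ hΔ =>
      ih _ (hlt Δ) rfl (hΔ.induce_neighborSet v)
    rcases h.iso_or_odd hc hcc v (hloc Γ h) with e | e | h1
    · exact Or.inr (Or.inr (Or.inl e))
    · exact Or.inr (Or.inr (Or.inr e))
    rcases h.compl.iso_or_odd hcc (by rwa [compl_compl]) v (hloc Γᶜ h.compl) with
      ⟨⟨e⟩⟩ | ⟨⟨e⟩⟩ | h2
    · obtain ⟨e1⟩ := nonempty_iso_compl e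
      obtain ⟨e2⟩ := nonempty_compl_cycleGraph_five_iso
      rw [compl_compl] at e1
      exact Or.inr (Or.inr (Or.inl ⟨e1.trans e2⟩))
    · obtain ⟨e1⟩ := nonempty_iso_compl e
      obtain ⟨e2⟩ := nonempty_compl_rookGraph_iso
      rw [compl_compl] at e1
      exact Or.inr (Or.inr (Or.inr ⟨e1.trans e2⟩))
    · exact (h.not_odd_odd v h1 h2).elim

end Classification

end SimpleGraph

/-! ### Partitions into equal classes, and Gardiner's theorem -/

/-- A finite set with an equivalence relation whose classes are all identified with `W` is a
product with `W`. -/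
theorem exists_equiv_prod_of_setoid {V : Type*} {W : Type*} [Finite V] [Nonempty V]
    (s : Setoid V) (ε : ∀ a : V, {x // s a x} ≃ W) :
    ∃ (k : ℕ) (_ : 1 ≤ k) (e : V ≃ Fin k × W), (∀ x y, s x y ↔ (e x).1 = (e y).1) ∧
      ∀ x y, s x y → ∃ (a : V) (hx : s a x) (hy : s a y),
        (e x).2 = ε a ⟨x, hx⟩ ∧ (e y).2 = ε a ⟨y, hy⟩ := by
  obtain ⟨k, ⟨idx⟩⟩ := Finite.exists_equiv_fin (Quotient s)
  have hout : ∀ x, s (Quotient.mk s x).out x := fun x => Quotient.mk_out x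
  have hk : 1 ≤ k := by
    obtain ⟨x⟩ := ‹Nonempty V›
    exact Nat.one_le_of_lt (idx (Quotient.mk s x)).2
  have hcongr : ∀ (q q' : Quotient s) (x : V) (h : s q.out x) (h' : s q'.out x), q = q' →
      ε q.out ⟨x, h⟩ = ε q'.out ⟨x, h'⟩ := by
    rintro q _ x h h' rfl
    rfl
  let f : V → Fin k × W := fun x =>
    (idx (Quotient.mk s x), ε (Quotient.mk s x).out ⟨x, hout x⟩)
  have hf : Function.Bijective f := by
    constructor
    · intro x y hxy
      have h1 : Quotient.mk s x = Quotient.mk s y := idx.injective (congrArg Prod.fst hxy)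
      have h2 := congrArg Prod.snd hxy
      have hy : s (Quotient.mk s x).out y := h1 ▸ hout y
      simp only [f] at h2
      rw [hcongr _ (Quotient.mk s x) y (hout y) hy h1.symm] at h2
      exact congrArg Subtype.val ((ε _).injective h2)
    · rintro ⟨i, w⟩
      let x := (ε (idx.symm i).out).symm w
      have hx : Quotient.mk s (x : V) = idx.symm i :=
        (Quotient.sound x.2).symm.trans (Quotient.out_eq _)
      refine ⟨x, Prod.ext (by simp [f, hx]) ?_⟩
      simp only [f]
      rw [hcongr _ (idx.symm i) x (hout x) x.2 hx]
      exact (ε _).apply_symm_apply w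
  refine ⟨k, hk, Equiv.ofBijective f hf, fun x y => ?_, fun x y hxy => ?_⟩
  · simp only [Equiv.ofBijective_apply, f, idx.injective.eq_iff]
    exact Quotient.eq.symm
  · have h1 : Quotient.mk s x = Quotient.mk s y := Quotient.sound hxy
    have hy : s (Quotient.mk s x).out y := h1 ▸ hout y
    exact ⟨_, hout x, hy, rfl, hcongr _ _ y (hout y) hy h1.symm⟩

namespace SimpleGraph

theorem IsUltrahomogeneous.nonempty_iso_disjointCompleteGraphs {V : Type*} [Finite V] [Nonempty V]
    {Γ : SimpleGraph V} (h : Γ.IsUltrahomogeneous) (hc : Γ.IsClusterGraph) :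
    ∃ k n : ℕ, 1 ≤ k ∧ 1 ≤ n ∧ Nonempty (Γ ≃g disjointCompleteGraphs k n) := by
  let s : Setoid V := ⟨fun x y => x = y ∨ Γ.Adj x y, fun _ => Or.inl rfl,
    fun e => e.imp Eq.symm fun e => e.symm, by
      rintro x y z (rfl | h1) (rfl | h2)
      · exact Or.inl rfl
      · exact Or.inr h2
      · exact Or.inr h1
      · exact or_iff_not_imp_left.2 fun e => hc x y z h1 h2 e⟩
  obtain ⟨a⟩ := ‹Nonempty V›
  obtain ⟨n, ⟨ι⟩⟩ := Finite.exists_equiv_fin {x // s a x}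
  have hε : ∀ b, Nonempty ({x // s b x} ≃ Fin n) := fun b => by
    obtain ⟨σ, rfl⟩ := h.exists_iso_one b a
    refine ⟨(σ.toEquiv.subtypeEquiv fun x => ?_).trans ι⟩
    exact or_congr σ.injective.eq_iff.symm σ.map_adj_iff.symm
  have : Nonempty V := ⟨a⟩
  obtain ⟨k, hk, e, he, -⟩ := exists_equiv_prod_of_setoid s fun b => (hε b).some
  refine ⟨k, n, hk, Nat.one_le_of_lt (ι ⟨a, Or.inl rfl⟩).2, ⟨e, ?_⟩⟩
  intro x y
  have h1 : (x = y ∨ Γ.Adj x y) ↔ (e x).1 = (e y).1 := he x y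
  have h2 : x = y ↔ (e x).1 = (e y).1 ∧ (e x).2 = (e y).2 := by
    rw [← Prod.ext_iff, e.injective.eq_iff]
  have h3 : Γ.Adj x y → x ≠ y := fun e => e.ne
  simp only [disjointCompleteGraphs]
  tauto

/-- **Gardiner's theorem**: finite ultrahomogeneous graphs are Gardiner graphs. -/
theorem IsUltrahomogeneous.isGardinerGraph {V : Type u} [Finite V] [Nonempty V]
    {Γ : SimpleGraph V} (h : Γ.IsUltrahomogeneous) : IsGardinerGraph Γ := by
  rcases IsUltrahomogeneous.classification _ rfl h with hc | hc | hc | ⟨⟨e⟩⟩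
  · exact Or.inl (h.nonempty_iso_disjointCompleteGraphs hc)
  · obtain ⟨k, n, hk, hn, ⟨e⟩⟩ := h.compl.nonempty_iso_disjointCompleteGraphs hc
    obtain ⟨e1⟩ := nonempty_iso_compl e
    obtain ⟨e2⟩ := nonempty_completeMultipartiteGraph_iso k n
    rw [compl_compl] at e1
    exact Or.inr (Or.inl ⟨k, n, hk, hn, ⟨e1.trans e2⟩⟩)
  · exact Or.inr (Or.inr (Or.inl hc))
  · obtain ⟨e1⟩ := nonempty_rookGraph_iso_lineGraph
    exact Or.inr (Or.inr (Or.inr ⟨e.trans e1.symm⟩))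

end SimpleGraph

namespace LColoredGraph

/-! ### Extending color-increasing maps -/

section Extension

variable {L : Type*} [PartialOrder L] [BoundedOrder L] {V : Type*} {W : Type*}

theorem edgeColor_comm (G : LColoredGraph L V) (x y : V) :
    G.edgeColor x y = G.edgeColor y x := by
  by_cases h : x = y
  · rw [h]
  · exact G.edgeColor_symm x y h

/-- Every edge-color increasing map on a set of vertices extends to such a map on all vertices. -/
def ExtendsHoms (G : LColoredGraph L V) : Prop :=
  ∀ (S : Set V) (f : V → V),
    (∀ x ∈ S, ∀ y ∈ S, G.edgeColor x y ≤ G.edgeColor (f x) (f y)) →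
      ∃ g : V → V, (∀ x y, G.edgeColor x y ≤ G.edgeColor (g x) (g y)) ∧ ∀ x ∈ S, g x = f x

theorem ExtendsHoms.isHHHomogeneous {G : LColoredGraph L V} {α : L}
    (hα : ∀ x, G.vertexColor x = α) (h : G.ExtendsHoms) : G.IsHHHomogeneous := by
  classical
  intro S T hS hT _ _ f hf
  have hF : ∀ x : S, (fun y => if hy : y ∈ S then (f ⟨y, hy⟩ : V) else y) x = f x := fun x => by
    simp
  obtain ⟨g, hg, hgS⟩ := h S (fun y => if hy : y ∈ S then (f ⟨y, hy⟩ : V) else y)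
    (fun x hx y hy => by
      simp only [dif_pos hx, dif_pos hy]
      exact hf.2 ⟨x, hx⟩ ⟨y, hy⟩)
  exact ⟨g, ⟨fun x => by rw [hα, hα], hg⟩, fun x => (hgS x x.2).trans (hF x)⟩

theorem IsHHHomogeneous.isMHHomogeneous {G : LColoredGraph L V} (h : G.IsHHHomogeneous) :
    G.IsMHHomogeneous :=
  fun S T hS hT hS' hT' f hf => h S T hS hT hS' hT' f hf.1

/-- Homogeneity restated for ambient maps. Substructures are nonempty, so the empty set is served by
the identity. -/
theorem IsMHHomogeneous.exists_hom [Finite V] {G : LColoredGraph L V} {α : L}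
    (hα : ∀ x, G.vertexColor x = α) (h : G.IsMHHomogeneous) (S : Set V) (f : V → V)
    (hinj : Set.InjOn f S)
    (hf : ∀ x ∈ S, ∀ y ∈ S, G.edgeColor x y ≤ G.edgeColor (f x) (f y)) :
    ∃ g : V → V, (∀ x y, G.edgeColor x y ≤ G.edgeColor (g x) (g y)) ∧ ∀ x ∈ S, g x = f x := by
  rcases S.eq_empty_or_nonempty with rfl | hS
  · exact ⟨id, fun _ _ => le_rfl, by simp⟩
  obtain ⟨g, hg, hgS⟩ := h S (f '' S) hS (hS.image f) (Set.toFinite _) (Set.toFinite _)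
    (fun x => ⟨f x, Set.mem_image_of_mem f x.2⟩)
    ⟨⟨fun x => by simp only [induce, hα, le_refl], fun x y => hf x x.2 y y.2⟩,
      fun x y hxy => Subtype.ext (hinj x.2 y.2 (congrArg Subtype.val hxy))⟩
  exact ⟨g, hg.2, fun x hx => hgS ⟨x, hx⟩⟩

theorem ExtendsHoms.of_equiv {G : LColoredGraph L V} {H : LColoredGraph L W} (e : V ≃ W)
    (he : ∀ x y, H.edgeColor (e x) (e y) = G.edgeColor x y) (h : H.ExtendsHoms) :
    G.ExtendsHoms := by
  intro S f hf
  have he' : ∀ x y, G.edgeColor (e.symm x) (e.symm y) = H.edgeColor x y := fun x y => by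
    rw [← he, e.apply_symm_apply, e.apply_symm_apply]
  obtain ⟨g, hg, hgS⟩ := h (e '' S) (fun w => e (f (e.symm w))) (by
    rintro _ ⟨x, hx, rfl⟩ _ ⟨y, hy, rfl⟩
    simpa [he] using hf x hx y hy)
  refine ⟨fun x => e.symm (g (e x)), fun x y => ?_, fun x hx => ?_⟩
  · rw [he', ← he]
    exact hg _ _
  · simp [hgS (e x) ⟨x, hx, rfl⟩]

/-- Two vertices of one copy are joined by a nonzero color, so their images share a copy. Each copy
is extended separately; pairs across copies have color `⊥` and impose nothing. -/
theorem ExtendsHoms.copies {k : ℕ} (hk : 1 ≤ k) {H : LColoredGraph L W}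
    (hne : ∀ x y, x ≠ y → H.edgeColor x y ≠ ⊥) (h : H.ExtendsHoms) :
    (copies k hk H).ExtendsHoms := by
  classical
  intro S f hf
  have hidx : ∀ x ∈ S, ∀ y ∈ S, x.1 = y.1 → (f x).1 = (f y).1 := by
    intro x hx y hy hxy
    by_contra hcon
    have h1 := hf x hx y hy
    simp only [LColoredGraph.copies, if_pos hxy, if_neg hcon, le_bot_iff] at h1
    by_cases e : x.2 = y.2
    · exact hcon (by rw [Prod.ext hxy e])
    · exact hne _ _ e h1
  have hex : ∀ i, ∃ (j : Fin k) (g : W → W),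
      (∀ x y, H.edgeColor x y ≤ H.edgeColor (g x) (g y)) ∧
        ∀ w, (i, w) ∈ S → f (i, w) = (j, g w) := by
    intro i
    obtain ⟨g, hg, hgS⟩ := h {w | (i, w) ∈ S} (fun w => (f (i, w)).2) (by
      intro x hx y hy
      have h1 := hf (i, x) hx (i, y) hy
      simpa only [LColoredGraph.copies, if_pos (hidx _ hx _ hy rfl), if_true] using h1)
    by_cases hi : ∃ w, (i, w) ∈ S
    · obtain ⟨w, hw⟩ := hi
      exact ⟨(f (i, w)).1, g, hg, fun x hx => Prod.ext (hidx _ hx _ hw rfl) (hgS x hx).symm⟩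
    · exact ⟨i, g, hg, fun w hw => absurd ⟨w, hw⟩ hi⟩
  choose j g hg hgS using hex
  refine ⟨fun x => (j x.1, g x.1 x.2), fun x y => ?_, fun x hx => (hgS x.1 x.2 hx).symm⟩
  by_cases e : x.1 = y.1
  · simp only [LColoredGraph.copies, e, if_true]
    exact hg _ _ _
  · simp only [LColoredGraph.copies, if_neg e, bot_le]

/-- Collapsing a pair would lower `⊤` to `⊥`, so partial maps are injective, and every permutation
preserves the colors. -/
theorem extendsHoms_of_top [Finite W] {H : LColoredGraph L W} (hbt : (⊥ : L) ≠ ⊤)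
    (htop : ∀ x y, x ≠ y → H.edgeColor x y = ⊤) : H.ExtendsHoms := by
  intro S f hf
  obtain ⟨π, hπ⟩ := SimpleGraph.exists_perm_of_eq_iff_eq (fun x : S => (x : W)) (fun x => f x)
    (fun x y => ⟨fun e => by rw [e], fun e => by
      by_contra hne
      have := hf x x.2 y y.2
      rw [htop _ _ hne, e, H.edgeColor_self, le_bot_iff] at this
      exact hbt this.symm⟩)
  refine ⟨π, fun x y => ?_, fun x hx => hπ ⟨x, hx⟩⟩
  by_cases e : x = y
  · simp [e, edgeColor_self]
  · rw [htop (π x) (π y) (π.injective.ne e)]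
    exact le_top

end Extension

/-! ### The support of an MH-homogeneous graph -/

section Support

variable {L : Type*} [PartialOrder L] [BoundedOrder L] {V : Type*}

/-- The graph of all pairs whose color is not `⊥`. -/
def support (G : LColoredGraph L V) : SimpleGraph V where
  Adj x y := G.edgeColor x y ≠ ⊥
  symm := ⟨fun x y h => by rwa [G.edgeColor_comm] at h⟩
  loopless := ⟨fun x h => h (G.edgeColor_self x)⟩

variable {G : LColoredGraph L V}

theorem support_adj_map {g : V → V} (hg : ∀ x y, G.edgeColor x y ≤ G.edgeColor (g x) (g y))
    {x y : V} (h : G.support.Adj x y) : G.support.Adj (g x) (g y) :=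
  fun e => h (le_bot_iff.1 (e ▸ hg x y))

theorem isNClique_image [DecidableEq V] {g : V → V}
    (hg : ∀ x y, G.edgeColor x y ≤ G.edgeColor (g x) (g y)) {K : Finset V} {n : ℕ}
    (hK : G.support.IsNClique n K) : G.support.IsNClique n (K.image g) := by
  have hinj : Set.InjOn g K := fun x hx y hy e => by
    by_contra hne
    exact (support_adj_map hg (hK.isClique hx hy hne)).ne e
  refine ⟨?_, (Finset.card_image_of_injOn hinj).trans hK.card_eq⟩
  intro a ha b hb hab
  simp only [Finset.coe_image, Set.mem_image] at ha hb
  obtain ⟨x, hx, rfl⟩ := ha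
  obtain ⟨y, hy, rfl⟩ := hb
  exact support_adj_map hg (hK.isClique hx hy fun e => hab (e ▸ rfl))

namespace IsMHHomogeneous

variable [Finite V] {α : L}

theorem exists_hom_apply (hα : ∀ x, G.vertexColor x = α) (h : G.IsMHHomogeneous) (a b : V) :
    ∃ g : V → V, (∀ x y, G.edgeColor x y ≤ G.edgeColor (g x) (g y)) ∧ g a = b := by
  obtain ⟨g, hg, hga⟩ := h.exists_hom hα {a} (fun _ => b) (by simp)
    (by simp [edgeColor_self])
  exact ⟨g, hg, hga a rfl⟩

/-- Otherwise z ↦ k, with the members of K not joined to z fixed, is a monomorphism: all its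
constraints involving z are on pairs of color `⊥`. For an extension g, every `g x` with x in K is
adjacent to k, so k enlarges the maximum clique g(K). -/
theorem mem_of_adj (hα : ∀ x, G.vertexColor x = α) (h : G.IsMHHomogeneous) {K : Finset V}
    (hK : G.support.IsNClique G.support.cliqueNum K) {k z : V} (hk : k ∈ K)
    (hkz : G.support.Adj k z) : z ∈ K := by
  classical
  by_contra hz
  have hval : ∀ x, x ∈ K ∧ ¬G.support.Adj x z → Function.update id z k x = x := fun x hx =>
    Function.update_of_ne (show x ≠ z from fun e => hz (e ▸ hx.1)) _ _
  have hnk : ∀ x, x ∈ K ∧ ¬G.support.Adj x z → x ≠ k := fun x hx e => hx.2 (e ▸ hkz)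
  have hbot : ∀ x, x ∈ K ∧ ¬G.support.Adj x z → G.edgeColor x z = ⊥ := fun x hx =>
    not_not.1 hx.2
  obtain ⟨g, hg, hgS⟩ := h.exists_hom hα (insert z {x | x ∈ K ∧ ¬G.support.Adj x z})
    (Function.update id z k)
    (by
      rintro x (rfl | hx) y (rfl | hy) hxy
      · rfl
      · rw [Function.update_self, hval y hy] at hxy
        exact absurd hxy.symm (hnk y hy)
      · rw [Function.update_self, hval x hx] at hxy
        exact absurd hxy (hnk x hx)
      · rwa [hval x hx, hval y hy] at hxy)
    (by
      rintro x (rfl | hx) y (rfl | hy)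
      · simp [edgeColor_self]
      · rw [G.edgeColor_comm, hbot y hy]; exact bot_le
      · rw [hbot x hx]; exact bot_le
      · rw [hval x hx, hval y hy])
  have hgz : g z = k := (hgS z (Or.inl rfl)).trans (Function.update_self _ _ _)
  have hadj : ∀ x ∈ K, G.support.Adj k (g x) := by
    intro x hx
    by_cases hxz : G.support.Adj x z
    · rw [← hgz]
      exact (support_adj_map hg hxz).symm
    · rw [hgS x (Or.inr ⟨hx, hxz⟩), hval x ⟨hx, hxz⟩]
      exact hK.isClique hk hx (hnk x ⟨hx, hxz⟩).symm
  have hK' := (isNClique_image hg hK).insert (a := k) (by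
    intro b hb
    obtain ⟨x, hx, rfl⟩ := Finset.mem_image.1 hb
    exact hadj x hx)
  have := hK'.isClique.card_le_cliqueNum
  rw [hK'.card_eq] at this
  omega

theorem exists_isNClique (hα : ∀ x, G.vertexColor x = α) (h : G.IsMHHomogeneous) (a : V) :
    ∃ K, G.support.IsNClique G.support.cliqueNum K ∧ a ∈ K := by
  classical
  have := Fintype.ofFinite V
  obtain ⟨K, hK⟩ := G.support.exists_isNClique_cliqueNum
  have hne : K.Nonempty := by
    have h1 : G.support.IsClique ({a} : Finset V) := by simp
    have h2 := h1.card_le_cliqueNum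
    rw [← hK.card_eq] at h2
    exact Finset.card_pos.1 (lt_of_lt_of_le (by simp) h2)
  obtain ⟨k, hk⟩ := hne
  obtain ⟨g, hg, rfl⟩ := h.exists_hom_apply hα k a
  exact ⟨K.image g, isNClique_image hg hK, Finset.mem_image_of_mem g hk⟩

theorem isClusterGraph_support (hα : ∀ x, G.vertexColor x = α) (h : G.IsMHHomogeneous) :
    G.support.IsClusterGraph := by
  intro x y z hxy hyz hxz
  obtain ⟨K, hK, hy⟩ := h.exists_isNClique hα y
  exact hK.isClique (h.mem_of_adj hα hK hy hxy.symm) (h.mem_of_adj hα hK hy hyz) hxz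

end IsMHHomogeneous

/-- The equivalence relation whose classes are the connected components of `G`, when the support
is a disjoint union of complete graphs. -/
def componentSetoid (G : LColoredGraph L V) (hc : G.support.IsClusterGraph) : Setoid V where
  r x y := x = y ∨ G.support.Adj x y
  iseqv := ⟨fun _ => Or.inl rfl, fun e => e.imp Eq.symm fun e => e.symm, by
    rintro x y z (rfl | h1) (rfl | h2)
    · exact Or.inl rfl
    · exact Or.inr h2
    · exact Or.inr h1
    · exact or_iff_not_imp_left.2 fun e => hc x y z h1 h2 e⟩

namespace IsMHHomogeneous

variable [Finite V] {α : L}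

theorem card_component (hα : ∀ x, G.vertexColor x = α) (h : G.IsMHHomogeneous)
    (hc : G.support.IsClusterGraph) (a : V) :
    Nat.card {x // G.componentSetoid hc a x} = G.support.cliqueNum := by
  obtain ⟨K, hK, ha⟩ := h.exists_isNClique hα a
  rw [← hK.card_eq, ← Fintype.card_coe, ← Nat.card_eq_fintype_card]
  refine Nat.card_congr (Equiv.subtypeEquivRight fun x => ⟨?_, fun hx => ?_⟩)
  · rintro (rfl | e)
    exacts [ha, h.mem_of_adj hα hK ha e]
  · exact or_iff_not_imp_left.2 fun e => hK.isClique ha hx e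

/-- Endomorphisms restrict to bijections between components. -/
theorem exists_equiv_component (hα : ∀ x, G.vertexColor x = α) (h : G.IsMHHomogeneous)
    (hc : G.support.IsClusterGraph) {g : V → V}
    (hg : ∀ x y, G.edgeColor x y ≤ G.edgeColor (g x) (g y)) {a b : V}
    (hab : G.componentSetoid hc (g a) b) :
    ∃ ε : {x // G.componentSetoid hc a x} ≃ {x // G.componentSetoid hc b x},
      ∀ x, (ε x : V) = g x := by
  have hmap : ∀ x y, G.componentSetoid hc x y → G.componentSetoid hc (g x) (g y) := fun x y =>
    Or.imp (congrArg g) (support_adj_map hg)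
  let f : {x // G.componentSetoid hc a x} → {x // G.componentSetoid hc b x} := fun x =>
    ⟨g x, Setoid.trans' _ (Setoid.symm' _ hab) (hmap _ _ x.2)⟩
  have hf : Function.Injective f := by
    intro x y hxy
    rcases Setoid.trans' _ (Setoid.symm' _ x.2) y.2 with e | e
    · exact Subtype.ext e
    · exact absurd (congrArg Subtype.val hxy) (support_adj_map hg e).ne
  have hcard : Nat.card {x // G.componentSetoid hc a x} =
      Nat.card {x // G.componentSetoid hc b x} := by
    rw [h.card_component hα hc, h.card_component hα hc]
  exact ⟨Equiv.ofBijective f ((Nat.bijective_iff_injective_and_card f).2 ⟨hf, hcard⟩),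
    fun _ => rfl⟩

/-- An endomorphism g' taking `g x` back to x makes g' ∘ g a permutation π of the component. Colors
cannot fall along powers of π, and some power is the identity, so no step raises them. -/
theorem edgeColor_map (hα : ∀ x, G.vertexColor x = α) (h : G.IsMHHomogeneous)
    (hc : G.support.IsClusterGraph) {g : V → V}
    (hg : ∀ x y, G.edgeColor x y ≤ G.edgeColor (g x) (g y)) {x y : V}
    (hxy : G.componentSetoid hc x y) : G.edgeColor (g x) (g y) = G.edgeColor x y := by
  obtain ⟨g', hg', hgx⟩ := h.exists_hom_apply hα (g x) x
  obtain ⟨π, hπ⟩ := h.exists_equiv_component hα hc (g := g' ∘ g) (a := x) (b := x)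
    (fun u v => (hg u v).trans (hg' _ _)) (by rw [Function.comp_apply, hgx])
  have hmono : ∀ (m : ℕ) (u v : {z // G.componentSetoid hc x z}),
      G.edgeColor u v ≤ G.edgeColor ((π ^ m) u : {z // _}) ((π ^ m) v : {z // _}) := by
    intro m
    induction m with
    | zero => intro u v; exact le_rfl
    | succ m ih =>
      intro u v
      rw [pow_succ, Equiv.Perm.mul_apply, Equiv.Perm.mul_apply]
      refine le_trans ?_ (ih _ _)
      rw [hπ, hπ]
      exact (hg _ _).trans (hg' _ _)
  obtain ⟨m, hm⟩ : ∃ m, π ^ (m + 1) = 1 :=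
    ⟨orderOf π - 1, by rw [Nat.sub_add_cancel (orderOf_pos π), pow_orderOf_eq_one]⟩
  refine le_antisymm ?_ (hg x y)
  have h1 := hmono m (π ⟨x, Or.inl rfl⟩) (π ⟨y, hxy⟩)
  rw [← Equiv.Perm.mul_apply, ← Equiv.Perm.mul_apply, ← pow_succ, hm] at h1
  refine (hg' _ _).trans (le_trans (le_of_eq ?_) h1)
  rw [hπ, hπ]
  rfl

end IsMHHomogeneous

end Support

end LColoredGraph

/-! ### Red and blue: the diamond and the main equivalence -/

theorem M2.bot_ne_top : (⊥ : M2) ≠ ⊤ := M2.noConfusion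

theorem M2.eq_of_le {a b : M2} (h : a ≤ b) (ha : a ≠ ⊥) (hb : b ≠ ⊤) : a = b := by
  rcases h with h | h | h
  · exact absurd h ha
  · exact absurd h hb
  · exact h

namespace LColoredGraph

/-- Red and blue are incomparable and `⊤` does not occur, so partial homomorphisms preserve colors
exactly and are partial isomorphisms of the red graph. -/
theorem extendsHoms_of_isUltrahomogeneous {W : Type*} {H : LColoredGraph M2 W}
    (hne : ∀ x y, x ≠ y → H.edgeColor x y = M2.red ∨ H.edgeColor x y = M2.blue)
    (h : (H.colorGraph M2.red).IsUltrahomogeneous) : H.ExtendsHoms := by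
  intro S f hf
  have hbot : ∀ x y, x ≠ y → H.edgeColor x y ≠ ⊥ := fun x y hxy => by
    rcases hne x y hxy with e | e <;> rw [e] <;> exact M2.noConfusion
  have htop : ∀ x y, H.edgeColor x y ≠ ⊤ := fun x y => by
    by_cases hxy : x = y
    · rw [hxy, H.edgeColor_self]; exact M2.bot_ne_top
    · rcases hne x y hxy with e | e <;> rw [e] <;> exact M2.noConfusion
  have hinj : Set.InjOn f S := by
    intro x hx y hy e
    by_contra hxy
    have := hf x hx y hy
    rw [e, H.edgeColor_self, le_bot_iff] at this
    exact hbot x y hxy this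
  obtain ⟨σ, hσ⟩ := h S f hinj fun x hx y hy => by
    by_cases hxy : x = y
    · simp [hxy]
    · simp only [colorGraph, ne_eq, hinj.eq_iff hx hy,
        M2.eq_of_le (hf x hx y hy) (hbot x y hxy) (htop _ _)]
  refine ⟨σ, fun x y => ?_, hσ⟩
  by_cases hxy : x = y
  · rw [hxy, H.edgeColor_self]
    exact bot_le
  have hxy' : σ x ≠ σ y := σ.injective.ne hxy
  have hred : H.edgeColor (σ x) (σ y) = M2.red ↔ H.edgeColor x y = M2.red :=
    ⟨fun e => (σ.map_adj_iff.1 ⟨hxy', e⟩).2, fun e => (σ.map_adj_iff.2 ⟨hxy, e⟩).2⟩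
  rcases hne x y hxy with e | e
  · rw [hred.2 e, e]
  · rw [e, (hne _ _ hxy').resolve_left fun e' => M2.noConfusion ((hred.1 e').symm.trans e)]

theorem support_adj_of_component {L : Type*} [PartialOrder L] [BoundedOrder L] {V : Type*}
    {G : LColoredGraph L V} (hc : G.support.IsClusterGraph) {a x y : V}
    (hx : G.componentSetoid hc a x) (hy : G.componentSetoid hc a y) (hne : x ≠ y) :
    G.support.Adj x y :=
  (Setoid.trans' _ (Setoid.symm' _ hx) hy).resolve_left hne

theorem IsMHHomogeneous.isUltrahomogeneous_induce {V : Type*} [Finite V] {G : LColoredGraph M2 V}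
    {α : M2} (hα : ∀ x, G.vertexColor x = α) (h : G.IsMHHomogeneous)
    (hc : G.support.IsClusterGraph) (a : V) (ha : {x | G.componentSetoid hc a x}.Nonempty)
    (htop : ∀ x y, G.edgeColor x y ≠ ⊤) :
    ((G.induce {x | G.componentSetoid hc a x} ha).colorGraph M2.red).IsUltrahomogeneous := by
  classical
  intro S f hf hadj
  -- A point s of S is needed to ensure that the extension maps the component of a to itself.
  rcases S.eq_empty_or_nonempty with rfl | ⟨s, hs⟩
  · exact ⟨RelIso.refl _, by simp⟩
  have hadj' : ∀ x y : {x | G.componentSetoid hc a x}, x ≠ y → G.edgeColor x y ≠ ⊥ :=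
    fun x y hxy => support_adj_of_component hc x.2 y.2 fun e => hxy (Subtype.ext e)
  have key : ∀ c d : M2, c ≠ ⊥ → c ≠ ⊤ → d ≠ ⊥ → d ≠ ⊤ → (d = M2.red ↔ c = M2.red) → c = d := by
    rintro (_ | _ | _ | _) (_ | _ | _ | _) h1 h2 h3 h4 h5 <;>
      first
        | rfl
        | exact absurd rfl h1
        | exact absurd rfl h2
        | exact absurd rfl h3
        | exact absurd rfl h4
        | simp at h5
  let F : V → V := fun x => if hx : G.componentSetoid hc a x then (f ⟨x, hx⟩ : V) else x
  have hF : ∀ x : {x | G.componentSetoid hc a x}, F x = f x := fun x => dif_pos x.2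
  obtain ⟨g, hg, hgS⟩ := h.exists_hom hα (Subtype.val '' S) F
    (by
      rintro _ ⟨x, hx, rfl⟩ _ ⟨y, hy, rfl⟩ e
      rw [hF, hF] at e
      rw [hf hx hy (Subtype.ext e)])
    (by
      rintro _ ⟨x, hx, rfl⟩ _ ⟨y, hy, rfl⟩
      rw [hF, hF]
      by_cases hxy : x = y
      · simp [hxy, edgeColor_self]
      have hxy' : f x ≠ f y := fun e => hxy (hf hx hy e)
      refine (key _ _ (hadj' x y hxy) (htop _ _) (hadj' _ _ hxy') (htop _ _) ?_).le
      have := hadj x hx y hy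
      simpa only [colorGraph, induce, ne_eq, hxy, hxy', not_false_eq_true, true_and] using this)
  have hgf : ∀ x ∈ S, g x = f x := fun x hx => (hgS x ⟨x, hx, rfl⟩).trans (hF x)
  have hga : G.componentSetoid hc (g a) a := by
    have h1 : G.componentSetoid hc (g a) (g s) :=
      Or.imp (congrArg g) (support_adj_map hg) s.2
    rw [hgf s hs] at h1
    exact Setoid.trans' _ h1 (Setoid.symm' _ (f s).2)
  obtain ⟨ε, hε⟩ := h.exists_equiv_component hα hc hg hga
  refine ⟨⟨ε, ?_⟩, fun x hx => Subtype.ext ((hε x).trans (hgf x hx))⟩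
  intro x y
  refine and_congr ε.injective.ne_iff (Eq.congr_left ?_)
  simp only [induce]
  rw [hε, hε]
  exact h.edgeColor_map hα hc hg (Setoid.trans' _ (Setoid.symm' _ x.2) y.2)

theorem IsMHHomogeneous.exists_copies {V : Type u} [Finite V] {G : LColoredGraph M2 V}
    {α : M2} (hα : ∀ x, G.vertexColor x = α) (h : G.IsMHHomogeneous) :
    ∃ (k : ℕ) (hk : 1 ≤ k) (W : Type u) (H : LColoredGraph M2 W),
      G.IsIsomorphic (copies k hk H) ∧
        ((∃ (n : ℕ) (hn : 1 ≤ n), H.IsIsomorphic (uniform n hn α (⊤ : M2))) ∨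
          (H.IsVertexUniform ∧ IsGardinerGraph (H.colorGraph M2.red) ∧
            H.colorGraph M2.blue = (H.colorGraph M2.red)ᶜ)) := by
  have hc := h.isClusterGraph_support hα
  have := G.nonempty
  obtain ⟨a⟩ := G.nonempty
  have ha : {x | G.componentSetoid hc a x}.Nonempty := ⟨a, Or.inl rfl⟩
  have hε : ∀ b, ∃ ε : {x // G.componentSetoid hc b x} ≃ {x // G.componentSetoid hc a x},
      ∀ x y, G.edgeColor (ε x : V) (ε y) = G.edgeColor x y := by
    intro b
    obtain ⟨g, hg, hgb⟩ := h.exists_hom_apply hα b a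
    obtain ⟨ε, hε⟩ := h.exists_equiv_component hα hc hg (a := b) (b := a) (by rw [hgb])
    refine ⟨ε, fun x y => ?_⟩
    rw [hε, hε]
    exact h.edgeColor_map hα hc hg (Setoid.trans' _ (Setoid.symm' _ x.2) y.2)
  choose ε hε using hε
  obtain ⟨k, hk, e, he1, he2⟩ := exists_equiv_prod_of_setoid (G.componentSetoid hc) ε
  have hadj : ∀ x y : {x | G.componentSetoid hc a x}, x ≠ y → G.support.Adj x y := fun x y hxy =>
    support_adj_of_component hc x.2 y.2 fun e => hxy (Subtype.ext e)
  refine ⟨k, hk, {x | G.componentSetoid hc a x}, G.induce _ ha, ⟨e, fun x => ?_, fun x y => ?_⟩, ?_⟩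
  · simp only [copies, induce, hα]
  · by_cases hxy : G.componentSetoid hc x y
    · obtain ⟨b, hx, hy, e1, e2⟩ := he2 x y hxy
      simp only [copies, induce, (he1 x y).1 hxy, if_true, e1, e2]
      exact hε b ⟨x, hx⟩ ⟨y, hy⟩
    · simp only [copies, mt (he1 x y).2 hxy, if_false]
      exact (not_not.1 fun e => hxy (Or.inr e)).symm
  by_cases ht : ∃ u v, G.edgeColor u v = ⊤
  · left
    obtain ⟨u, v, huv⟩ := ht
    have huv' : u ≠ v := by
      rintro rfl
      exact M2.bot_ne_top ((G.edgeColor_self u).symm.trans huv)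
    -- Any edge xy can be sent onto uv, whose color is `⊤`; the extension preserves colors within
    -- components, so xy already had color `⊤`.
    have htop : ∀ x y, G.support.Adj x y → G.edgeColor x y = ⊤ := by
      classical
      intro x y hxy
      have h1 : (fun z => if z = x then u else v) x = u := if_pos rfl
      have h2 : (fun z => if z = x then u else v) y = v := if_neg hxy.ne'
      obtain ⟨g, hg, hgS⟩ := h.exists_hom hα {x, y} (fun z => if z = x then u else v)
        (by
          rintro _ (rfl | rfl) _ (rfl | rfl) e
          · rfl
          · exact absurd (h1.symm.trans (e.trans h2)) huv'
          · exact absurd (h1.symm.trans (e.symm.trans h2)) huv'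
          · rfl)
        (by
          rintro _ (rfl | rfl) _ (rfl | rfl)
          · simp [edgeColor_self]
          · simp [hxy.ne', huv]
          · simp [hxy.ne', G.edgeColor_comm v u, huv]
          · simp [edgeColor_self])
      rw [← h.edgeColor_map hα hc hg (Or.inr hxy), hgS x (by simp), hgS y (by simp)]
      simpa [hxy.ne'] using huv
    obtain ⟨n, ⟨ι⟩⟩ := Finite.exists_equiv_fin {x | G.componentSetoid hc a x}
    refine ⟨n, Nat.one_le_of_lt (ι ⟨a, Or.inl rfl⟩).2, ι, fun x => ?_, fun x y => ?_⟩
    · simp only [uniform, induce, hα]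
    · by_cases hxy : x = y
      · simp [uniform, induce, hxy, edgeColor_self]
      · simp only [uniform, induce, ι.injective.eq_iff, hxy, if_false]
        exact (htop _ _ (hadj x y hxy)).symm
  · right
    push Not at ht
    refine ⟨⟨α, fun x => hα x⟩, ?_, ?_⟩
    · have : Nonempty {x | G.componentSetoid hc a x} := ha.to_subtype
      exact (h.isUltrahomogeneous_induce hα hc a ha ht).isGardinerGraph
    · ext x y
      simp only [colorGraph, SimpleGraph.compl_adj, induce]
      have key : ∀ c : M2, c ≠ ⊥ → c ≠ ⊤ → (c = M2.blue ↔ ¬c = M2.red) := by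
        rintro (_ | _ | _ | _) h1 h2
        · exact absurd rfl h1
        · simp
        · simp
        · exact absurd rfl h2
      by_cases hxy : x = y
      · simp [hxy]
      · simp [hxy, key _ (hadj x y hxy) (ht x y)]

end LColoredGraph

theorem mainTheorem2 {V : Type u} [Finite V] (G : LColoredGraph M2 V) (α : M2)
    (hα : ∀ x, G.vertexColor x = α) :
    List.TFAE [
      G.IsHHHomogeneous,
      G.IsMHHomogeneous,
      ∃ (k : ℕ) (hk : 1 ≤ k) (W : Type u) (H : LColoredGraph M2 W),
        G.IsIsomorphic (LColoredGraph.copies k hk H) ∧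
        ((∃ (n : ℕ) (hn : 1 ≤ n),
            H.IsIsomorphic (LColoredGraph.uniform n hn α (⊤ : M2))) ∨
          (H.IsVertexUniform ∧ IsGardinerGraph (H.colorGraph M2.red) ∧
            H.colorGraph M2.blue = (H.colorGraph M2.red)ᶜ))] := by
  tfae_have 1 → 2 := fun h => h.isMHHomogeneous
  tfae_have 2 → 3 := fun h => h.exists_copies hα
  tfae_have 3 → 1 := by
    rintro ⟨k, hk, W, H, ⟨e, -, he⟩, ⟨n, hn, ι, -, hι⟩ | ⟨-, hG, hcompl⟩⟩
    · have htop : ∀ x y, x ≠ y → H.edgeColor x y = ⊤ := fun x y hxy => by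
        rw [← hι]
        exact if_neg (ι.injective.ne hxy)
      have : Finite W := Finite.of_equiv _ ι.symm
      exact (((LColoredGraph.extendsHoms_of_top M2.bot_ne_top htop).copies hk fun x y hxy => by
        rw [htop x y hxy]; exact M2.bot_ne_top.symm).of_equiv e he).isHHHomogeneous hα
    · have hne : ∀ x y, x ≠ y → H.edgeColor x y = M2.red ∨ H.edgeColor x y = M2.blue := by
        intro x y hxy
        by_contra! hcon
        have h1 : (H.colorGraph M2.red)ᶜ.Adj x y := ⟨hxy, fun h => hcon.1 h.2⟩
        rw [← hcompl] at h1
        exact hcon.2 h1.2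
      exact (((LColoredGraph.extendsHoms_of_isUltrahomogeneous hne
        hG.isUltrahomogeneous).copies hk fun x y hxy => by
          rcases hne x y hxy with e | e <;> rw [e] <;> exact M2.noConfusion).of_equiv e
            he).isHHHomogeneous hα
  tfae_finish
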